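/- Let $r\ge 2$ and $n$ be integers and let $c,\varepsilon$ be real numbers such that $$0<c<r^{-3(r+14)(r+1)},\qquad 0<\varepsilon<r^{-24},\qquad n>e^{1/c}.$$ Let $G$ be a graph (finite, simple, undirected) of order $n$ with $$e(G)>\left(1-\frac1r-\varepsilon\right)\frac{n^2}{2}$$ edges. Then at least one of the following statements holds: (a) $G$ contains, as a (not necessarily induced) subgraph, a copy of $K_{r+1}\left(\lfloor c\log n\rfloor;\lceil n^{1-\sqrt c}\,\rceil\right)$, where $\log$ is the natural logarithm and $K_{r+1}(p;q)$ denotes the complete $(r+1)$-partite graph with $r$ classes of size $p$ and one class of size $q$; (b) $G$ differs from $T_r(n)$ in fewer than $\left(\varepsilon^{1/3}+c^{1/(3r+3)}\right)n^2$ edges, where $T_r(n)$ is the Turán graph, that is, the complete $r$-partite graph of order $n$ whose class sizes differ by at most one; this means that, for some bijection between $V(G)$ and $V(T_r(n))$, fewer than that many pairs of vertices form an edge in exactly one of the two graphs. -/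

import Mathlib

open scoped SimpleGraph symmDiff

/-- `K_k(s_1, …, s_k)`: the complete `k`-partite graph with class sizes `s 0, …, s (k - 1)`. -/
abbrev completePartiteGraph {k : ℕ} (s : Fin k → ℕ) : SimpleGraph (Σ i : Fin k, Fin (s i)) :=
  SimpleGraph.completeMultipartiteGraph fun i => Fin (s i)

/-- The class sizes of `K_k(p; q) = K_k(p, …, p, q)`: the last class has size `q`, and each of the
other `k - 1` classes has size `p`. -/
def lastClassSizes (k p q : ℕ) (i : Fin k) : ℕ := if (i : ℕ) + 1 = k then q else p

/-- `G` differs from `H` in fewer than `x` edges: for some identification of the two vertex sets,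
fewer than `x` pairs of vertices form an edge of exactly one of the two graphs; that is, `G` can be
turned into a copy of `H` by adding and deleting fewer than `x` edges altogether. -/
def DiffersInFewerThan {V W : Type*} [Finite V] (G : SimpleGraph V) (H : SimpleGraph W) (x : ℝ) :
    Prop :=
  ∃ φ : V ≃ W, ((G.edgeSet ∆ (H.comap φ).edgeSet).ncard : ℝ) < x

/-! Put `b = c ^ (1/(3r+3))` and `e = ε ^ (1/3)`, and split on whether `G` has at least `b³ n^(r+1)`
ordered `(r+1)`-cliques.

Many cliques. Fix `D` of order `r / b³` and keep the `r`-tuples that extend to cliques in at least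
`2n/D` ways. By induction these contain the transversals of a complete `r`-partite graph with `D *
s` vertices per class. A pigeonhole over subsets of these transversals keeps `s` of them with a
common set of extensions of size at least `n / (D * 2^(D * s))`. With `s = ⌊c log n⌋` this is at
least `n^(1-√c)`, which supplies the large last class
(`completePartiteGraph_isContained_of_many_cliques`).

Few cliques. Deleting the edges that lie in many `(r+1)`-cliques costs few edges. In the remaining
graph few vertices have degree well below `(1-1/r)n`: otherwise removing some of them would push the
density above the Turán density, and Moon–Moser supersaturation would give too many cliques
(`card_lt_of_forall_degree_lt`). The other vertices span no `(r+1)`-clique: two of its vertices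
would have so many common neighbours that their edge would lie in many cliques
(`cliqueTuples_compl_eq_empty`). The Andrásfai–Erdős–Sós theorem then gives an `r`-colouring. Large
degrees force its classes to be nearly balanced and nearly completely joined, so `G` is close to
`T_r(n)`. -/

namespace SimpleGraph

open Classical in
/-- The ordered `k`-cliques of `G` all of whose vertices lie in `S`. -/
noncomputable def cliqueTuples {V : Type*} [Fintype V] (G : SimpleGraph V) (S : Finset V) (k : ℕ) :
    Finset (Fin k → V) :=
  Finset.univ.filter fun y => (∀ i, y i ∈ S) ∧ ∀ i j, i ≠ j → G.Adj (y i) (y j)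

open Classical in
/-- The vertices of `S` that are adjacent to every entry of the tuple `y`. -/
noncomputable def commonNeighborsIn {V : Type*} (G : SimpleGraph V) (S : Finset V) {k : ℕ}
    (y : Fin k → V) : Finset V :=
  S.filter fun v => ∀ i, G.Adj v (y i)

/-! ### Counting ordered cliques: Moon–Moser and supersaturation -/

section CliqueTuples

variable {V : Type*} {G : SimpleGraph V} {S : Finset V} {k : ℕ}

lemma mem_commonNeighborsIn {y : Fin k → V} {v : V} :
    v ∈ G.commonNeighborsIn S y ↔ v ∈ S ∧ ∀ i, G.Adj v (y i) := by
  simp [commonNeighborsIn]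

/-- A vertex adjacent to all of `y` is counted `k + 1` times on the left. A vertex missing the entry
`j` is counted at most once, namely when `j` itself is removed. -/
lemma sum_card_commonNeighborsIn_removeNth_le (y : Fin (k + 1) → V) :
    ∑ i : Fin (k + 1), (G.commonNeighborsIn S (i.removeNth y)).card ≤
      S.card + k * (G.commonNeighborsIn S y).card := by
  classical
  have key : ∀ v ∈ S, (∑ i : Fin (k + 1), if ∀ j, G.Adj v (i.removeNth y j) then 1 else 0) ≤
      1 + k * (if ∀ j, G.Adj v (y j) then 1 else 0) := by
    intro v _
    split_ifs with h
    · calc _ ≤ ∑ i : Fin (k + 1), 1 := Finset.sum_le_sum fun i _ => by split_ifs <;> simp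
        _ = _ := by simp [add_comm]
    · push Not at h
      obtain ⟨j, hj⟩ := h
      rw [← Finset.card_filter]
      simp only [mul_zero, add_zero]
      refine Finset.card_le_one.2 fun a ha b hb => ?_
      have aux : ∀ a, (∀ l, G.Adj v (a.removeNth y l)) → a = j := by
        intro a ha
        by_contra hne
        obtain ⟨l, hl⟩ := Fin.exists_succAbove_eq (Ne.symm hne)
        exact hj (by simpa [Fin.removeNth, hl] using ha l)
      rw [aux a (by simpa using ha), aux b (by simpa using hb)]
  calc ∑ i : Fin (k + 1), (G.commonNeighborsIn S (i.removeNth y)).card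
      = ∑ i : Fin (k + 1), ∑ v ∈ S, (if ∀ j, G.Adj v (i.removeNth y j) then 1 else 0) := by
        refine Finset.sum_congr rfl fun i _ => ?_
        rw [commonNeighborsIn, Finset.card_filter]
    _ = ∑ v ∈ S, ∑ i : Fin (k + 1), (if ∀ j, G.Adj v (i.removeNth y j) then 1 else 0) :=
        Finset.sum_comm
    _ ≤ ∑ v ∈ S, (1 + k * (if ∀ j, G.Adj v (y j) then 1 else 0)) := Finset.sum_le_sum key
    _ = _ := by
        rw [Finset.sum_add_distrib, ← Finset.mul_sum, commonNeighborsIn, Finset.card_filter]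
        simp

variable [Fintype V]

lemma mem_cliqueTuples {y : Fin k → V} :
    y ∈ G.cliqueTuples S k ↔ (∀ i, y i ∈ S) ∧ ∀ i j, i ≠ j → G.Adj (y i) (y j) := by
  simp [cliqueTuples]

lemma insertNth_mem_cliqueTuples {i : Fin (k + 1)} {v : V} {z : Fin k → V} :
    i.insertNth (α := fun _ => V) v z ∈ G.cliqueTuples S (k + 1) ↔
      z ∈ G.cliqueTuples S k ∧ v ∈ G.commonNeighborsIn S z := by
  simp only [mem_cliqueTuples, mem_commonNeighborsIn, Fin.forall_iff_succAbove i,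
    Fin.insertNth_apply_same, Fin.insertNth_apply_succAbove]
  simp only [ne_eq, not_true_eq_false, false_implies, true_and, Fin.succAbove_right_inj,
    Fin.succAbove_ne, not_false_eq_true, true_implies, Fin.ne_succAbove, forall_and]
  constructor
  · rintro ⟨⟨h1, h2⟩, h3, -, h4⟩
    exact ⟨⟨h2, h4⟩, h1, h3⟩
  · rintro ⟨⟨h2, h4⟩, h1, h3⟩
    exact ⟨⟨h1, h2⟩, h3, fun i => (h3 i).symm, h4⟩

/-- The position `i` is arbitrary so that Moon–Moser can sum over every choice of the entry split
off. -/
lemma sum_cliqueTuples_succ (i : Fin (k + 1)) (F : (Fin (k + 1) → V) → ℕ) :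
    ∑ y ∈ G.cliqueTuples S (k + 1), F y =
      ∑ z ∈ G.cliqueTuples S k, ∑ v ∈ G.commonNeighborsIn S z,
        F (i.insertNth (α := fun _ => V) v z) := by
  rw [Finset.sum_sigma']
  symm
  refine Finset.sum_nbij' (fun p => i.insertNth (α := fun _ => V) p.2 p.1)
    (fun y => ⟨i.removeNth y, y i⟩) ?_ ?_ ?_ ?_ ?_
  · rintro ⟨z, v⟩ h
    exact insertNth_mem_cliqueTuples.2 (by simpa using h)
  · intro y hy
    rw [← Fin.insertNth_self_removeNth i y, insertNth_mem_cliqueTuples] at hy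
    simpa using hy
  · rintro ⟨z, v⟩ h
    simp
  · intro y hy
    simp
  · rintro ⟨z, v⟩ h
    rfl

lemma card_cliqueTuples_succ :
    (G.cliqueTuples S (k + 1)).card =
      ∑ z ∈ G.cliqueTuples S k, (G.commonNeighborsIn S z).card := by
  have := sum_cliqueTuples_succ (G := G) (S := S) (Fin.last k) fun _ => 1
  simpa using this

lemma card_cliqueTuples_zero : (G.cliqueTuples S 0).card = 1 := by
  rw [Finset.card_eq_one]
  exact ⟨Fin.elim0, by ext y; simp [mem_cliqueTuples, Subsingleton.elim y Fin.elim0]⟩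

lemma card_cliqueTuples_one : (G.cliqueTuples S 1).card = S.card := by
  rw [card_cliqueTuples_succ, Finset.sum_congr rfl (g := fun _ => S.card), Finset.sum_const,
    card_cliqueTuples_zero, one_smul]
  intro z _
  congr 1
  ext v
  simp [mem_commonNeighborsIn]

/-- The Moon–Moser inequality for ordered cliques. -/
lemma moon_moser (k : ℕ) :
    (k + 1) * (G.cliqueTuples S (k + 1)).card ^ 2 ≤ (G.cliqueTuples S k).card *
      (S.card * (G.cliqueTuples S (k + 1)).card + k * (G.cliqueTuples S (k + 2)).card) := by
  have h1 : ∀ i : Fin (k + 1), ∑ y ∈ G.cliqueTuples S (k + 1),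
      (G.commonNeighborsIn S (i.removeNth y)).card =
      ∑ z ∈ G.cliqueTuples S k, (G.commonNeighborsIn S z).card ^ 2 := by
    intro i
    rw [sum_cliqueTuples_succ i]
    refine Finset.sum_congr rfl fun z _ => ?_
    simp [sq]
  have h2 : (k + 1) * ∑ z ∈ G.cliqueTuples S k, (G.commonNeighborsIn S z).card ^ 2 ≤
      S.card * (G.cliqueTuples S (k + 1)).card + k * (G.cliqueTuples S (k + 2)).card := by
    calc _ = ∑ i : Fin (k + 1), ∑ y ∈ G.cliqueTuples S (k + 1),
          (G.commonNeighborsIn S (i.removeNth y)).card := by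
          rw [Finset.sum_congr rfl fun i _ => h1 i]; simp
      _ = ∑ y ∈ G.cliqueTuples S (k + 1), ∑ i : Fin (k + 1),
          (G.commonNeighborsIn S (i.removeNth y)).card := Finset.sum_comm
      _ ≤ ∑ y ∈ G.cliqueTuples S (k + 1), (S.card + k * (G.commonNeighborsIn S y).card) :=
          Finset.sum_le_sum fun y _ => sum_card_commonNeighborsIn_removeNth_le y
      _ = _ := by
          rw [Finset.sum_add_distrib, ← Finset.mul_sum, ← card_cliqueTuples_succ]
          simp [mul_comm]
  -- Cauchy–Schwarz, applied to the numbers of extensions of the `k`-cliques.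
  have h3 : (G.cliqueTuples S (k + 1)).card ^ 2 ≤ (G.cliqueTuples S k).card *
      ∑ z ∈ G.cliqueTuples S k, (G.commonNeighborsIn S z).card ^ 2 := by
    rw [card_cliqueTuples_succ]
    exact sq_sum_le_card_mul_sum_sq
  calc _ ≤ (k + 1) * ((G.cliqueTuples S k).card *
      ∑ z ∈ G.cliqueTuples S k, (G.commonNeighborsIn S z).card ^ 2) := Nat.mul_le_mul_left _ h3
    _ = (G.cliqueTuples S k).card *
      ((k + 1) * ∑ z ∈ G.cliqueTuples S k, (G.commonNeighborsIn S z).card ^ 2) := by ring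
    _ ≤ _ := Nat.mul_le_mul_left _ h2

/-- If the edge density of `G[S]` is at least `1 - q`, then an average ordered `k`-clique in `S`
extends to at least `(1 - k q) |S|` ordered `(k + 1)`-cliques. -/
lemma card_cliqueTuples_succ_ge {q : ℝ} (hq : 0 ≤ q)
    (h : (1 - q) * (S.card : ℝ) ^ 2 ≤ (G.cliqueTuples S 2).card) (k : ℕ) (hk : k * q ≤ 1) :
    (1 - k * q) * S.card * (G.cliqueTuples S k).card ≤ (G.cliqueTuples S (k + 1)).card := by
  induction k with
  | zero => simp [card_cliqueTuples_zero, card_cliqueTuples_one]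
  | succ k ih =>
    have hk' : (k : ℝ) * q ≤ 1 := by push_cast at hk; linarith
    specialize ih hk'
    rcases Nat.eq_zero_or_pos k with rfl | hkpos
    · rw [card_cliqueTuples_one]
      norm_num
      linarith
    have mm : (((k + 1) * (G.cliqueTuples S (k + 1)).card ^ 2 : ℕ) : ℝ) ≤
      (((G.cliqueTuples S k).card * (S.card * (G.cliqueTuples S (k + 1)).card +
        k * (G.cliqueTuples S (k + 2)).card) : ℕ) : ℝ) := by exact_mod_cast moon_moser k
    push_cast at mm hk ⊢
    set a : ℝ := ((G.cliqueTuples S k).card : ℝ)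
    set b : ℝ := ((G.cliqueTuples S (k + 1)).card : ℝ)
    set d : ℝ := ((G.cliqueTuples S (k + 2)).card : ℝ)
    set m : ℝ := (S.card : ℝ)
    have ha0 : 0 ≤ a := by positivity
    have hb0 : 0 ≤ b := by positivity
    have hd0 : 0 ≤ d := by positivity
    have hm0 : 0 ≤ m := by positivity
    change _ ≤ d
    rcases hb0.eq_or_lt with h0 | hbpos
    · rw [← h0]; simpa using hd0
    have hkp : (0 : ℝ) < k := by exact_mod_cast hkpos
    have hρ : 0 ≤ (1 - k * q) * m := mul_nonneg (by linarith) hm0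
    -- Moon–Moser combined with `(1 - kq) m a ≤ b`. After cancelling `b`, the identity `(k+1)(1-kq)
    -- - 1 = k(1-(k+1)q)` gives the claim; dividing by `k` is why the base case of density was
    -- treated apart.
    have h1 : ((k + 1) * ((1 - k * q) * m) * b) * b ≤ (m * b + k * d) * b := by
      calc _ = ((1 - k * q) * m) * ((k + 1) * b ^ 2) := by ring
        _ ≤ ((1 - k * q) * m) * (a * (m * b + k * d)) := by gcongr
        _ = ((1 - k * q) * m * a) * (m * b + k * d) := by ring
        _ ≤ b * (m * b + k * d) := by gcongr
        _ = _ := by ring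
    have h2 := le_of_mul_le_mul_right h1 hbpos
    refine le_of_mul_le_mul_left ?_ hkp
    nlinarith [h2]

/-- Supersaturation: if the edge density of `G[S]` exceeds the Turán density by `x`, then `S`
contains many ordered `(r + 1)`-cliques. -/
lemma card_cliqueTuples_ge_of_density {r : ℕ} (hr : 1 ≤ r) {x : ℝ} (hx : 0 ≤ x) (hxr : x ≤ 1 / r)
    (h : (1 - 1 / r + x) * (S.card : ℝ) ^ 2 ≤ (G.cliqueTuples S 2).card) :
    x * (S.card : ℝ) ^ (r + 1) / (r : ℝ) ^ r ≤ (G.cliqueTuples S (r + 1)).card := by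
  have hr0 : (0 : ℝ) < r := by exact_mod_cast hr
  have hr1 : (1 : ℝ) ≤ r := by exact_mod_cast hr
  have hq : 0 ≤ 1 / (r : ℝ) - x := by linarith
  have hstep := card_cliqueTuples_succ_ge (G := G) (S := S) hq (by convert h using 2; ring)
  have hle : ∀ k : ℕ, k ≤ r → (k : ℝ) * (1 / r - x) ≤ 1 - k * x - (r - k) / r := by
    intro k _
    field_simp
    nlinarith
  -- With `q = 1/r - x`, each extension before the last keeps a proportion at least `1/r`. The last
  -- one keeps `r x`, of which only `x / r` is used.
  have hge : ∀ k : ℕ, k + 1 ≤ r →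
      ((S.card : ℝ) / r) ^ k * S.card ≤ (G.cliqueTuples S (k + 1)).card := by
    intro k
    induction k with
    | zero => intro _; simp [card_cliqueTuples_one]
    | succ k ih =>
      intro hk
      have hk1 : ((k + 1 : ℕ) : ℝ) + 1 ≤ r := by exact_mod_cast hk
      have h1 := hle (k + 1) (by omega)
      have h2 : (1 : ℝ) / r ≤ (r - (k + 1 : ℕ)) / r := by gcongr; linarith
      have h3 : (0 : ℝ) ≤ (k + 1 : ℕ) * x := by positivity
      have h4 : (0 : ℝ) < 1 / r := by positivity
      refine le_trans ?_ (hstep (k + 1) (by linarith))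
      calc ((S.card : ℝ) / r) ^ (k + 1) * S.card
          = (1 / r) * S.card * (((S.card : ℝ) / r) ^ k * S.card) := by ring
        _ ≤ _ := by
          have h5 := ih (by omega)
          have h6 : 1 / (r : ℝ) ≤ 1 - ((k + 1 : ℕ) : ℝ) * (1 / r - x) := by linarith
          have h7 : 0 ≤ 1 - ((k + 1 : ℕ) : ℝ) * (1 / r - x) := by linarith
          gcongr
  have h1 := hle r le_rfl
  have h2 : ((r : ℝ) - r) / r = 0 := by simp
  have h3 : (0 : ℝ) ≤ r * x := by positivity
  refine le_trans ?_ (hstep r (by linarith))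
  obtain ⟨p, rfl⟩ : ∃ p, r = p + 1 := ⟨r - 1, by omega⟩
  have h4 := hge p le_rfl
  calc x * (S.card : ℝ) ^ (p + 1 + 1) / ((p + 1 : ℕ) : ℝ) ^ (p + 1)
      = (x / (p + 1 : ℕ)) * S.card * (((S.card : ℝ) / (p + 1 : ℕ)) ^ p * S.card) := by
        rw [div_pow, pow_succ ((p + 1 : ℕ) : ℝ)]; field_simp; ring
    _ ≤ _ := by
        have : x / (p + 1 : ℕ) ≤ (p + 1 : ℕ) * x := by
          rw [div_le_iff₀ hr0]
          nlinarith [mul_nonneg hx (sub_nonneg.2 hr1), mul_nonneg h3 (sub_nonneg.2 hr1)]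
        have h5 : x / (p + 1 : ℕ) ≤ 1 - ((p + 1 : ℕ) : ℝ) * (1 / (p + 1 : ℕ) - x) := by linarith
        have h6 : 0 ≤ x / (p + 1 : ℕ) := by positivity
        have h7 := h6.trans h5
        gcongr

end CliqueTuples

end SimpleGraph

/-! ### From many cliques to a large complete multipartite subgraph -/

open Classical in
/-- A dense bipartite relation between a small set `A` and a large set `V` contains a complete
bipartite piece that covers a fixed proportion of `V`. -/
lemma exists_card_eq_and_le_card_common {A V : Type*} [Fintype A] [Fintype V] (R : A → V → Prop)
    {D s : ℕ} (hD : 0 < D) (hs : 0 < s) (hA : Fintype.card A = D * s)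
    (h : ∀ a, 2 * Fintype.card V ≤ D * (Finset.univ.filter fun v => R a v).card) :
    ∃ S : Finset A, S.card = s ∧ Fintype.card V ≤
      D * 2 ^ (D * s) * (Finset.univ.filter fun v => ∀ a ∈ S, R a v).card := by
  set n := Fintype.card V with hn
  set good : Finset V :=
    Finset.univ.filter fun v => s ≤ (Finset.univ.filter fun a => R a v).card with hgood
  -- Double counting: the relation has at least `2ns` pairs, and vertices that are not good account
  -- for at most `ns` of them.
  have hgood_card : n ≤ D * good.card := by
    have h1 : ∑ a : A, (Finset.univ.filter fun v => R a v).card =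
        ∑ v : V, (Finset.univ.filter fun a => R a v).card := by
      simp only [Finset.card_filter]
      exact Finset.sum_comm
    have h2 : ∑ v : V, (Finset.univ.filter fun a => R a v).card ≤ good.card * (D * s) + n * s := by
      calc _ ≤ ∑ v : V, ((if v ∈ good then D * s else 0) + s) := by
            refine Finset.sum_le_sum fun v _ => ?_
            split_ifs with hv
            · exact ((Finset.card_le_univ _).trans hA.le).trans (Nat.le_add_right _ _)
            · simp only [hgood, Finset.mem_filter, Finset.mem_univ, true_and, not_le] at hv
              omega
        _ = _ := by
          rw [Finset.sum_add_distrib, Finset.sum_ite_mem]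
          simp [hn]
    have h3 : D * s * (2 * n) ≤
        D * ∑ a : A, (Finset.univ.filter fun v => R a v).card := by
      rw [Finset.mul_sum, ← hA]
      have := Finset.sum_le_sum fun a (_ : a ∈ Finset.univ) => h a
      simpa using this
    have h4 : (D * s) * n ≤ (D * s) * (D * good.card) := by
      have := h3.trans (Nat.mul_le_mul_left D (h1.le.trans h2))
      nlinarith
    exact Nat.le_of_mul_le_mul_left h4 (by positivity)
  by_contra! hcon
  -- Pigeonhole: each good vertex picks one `s`-set related to it, and `A` has only `2 ^ (D * s)`
  -- subsets.
  have hch : ∀ v : V, ∃ S : Finset A, v ∈ good → S.card = s ∧ ∀ a ∈ S, R a v := by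
    intro v
    by_cases hv : v ∈ good
    · obtain ⟨S, hS, hc⟩ := Finset.exists_subset_card_eq (Finset.mem_filter.1 hv).2
      exact ⟨S, fun _ => ⟨hc, fun a ha => (Finset.mem_filter.1 (hS ha)).2⟩⟩
    · exact ⟨∅, fun h => absurd h hv⟩
  choose F hF using hch
  have hnpos : 0 < n := by
    obtain ⟨S, -, hc⟩ := Finset.exists_subset_card_eq (s := (Finset.univ : Finset A)) (n := s)
      (by rw [Finset.card_univ, hA]; exact Nat.le_mul_of_pos_left _ hD)
    exact (Nat.zero_le _).trans_lt (hcon S hc)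
  have hfib : ∀ S : Finset A, D * 2 ^ (D * s) * (good.filter fun v => F v = S).card < n := by
    intro S
    by_cases hS : S.card = s
    · refine lt_of_le_of_lt (Nat.mul_le_mul_left _ (Finset.card_le_card fun v hv => ?_)) (hcon S hS)
      obtain ⟨hvg, rfl⟩ := Finset.mem_filter.1 hv
      exact Finset.mem_filter.2 ⟨Finset.mem_univ _, (hF v hvg).2⟩
    · rw [Finset.filter_false_of_mem]
      · simpa using hnpos
      · intro v hv hS'
        exact hS (hS' ▸ (hF v hv).1)
  have hsum : good.card = ∑ S : Finset A, (good.filter fun v => F v = S).card :=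
    Finset.card_eq_sum_card_fiberwise fun v _ => Finset.mem_coe.2 (Finset.mem_univ _)
  have hlt : D * 2 ^ (D * s) * good.card < 2 ^ (D * s) * n := by
    rw [hsum, Finset.mul_sum]
    calc _ < ∑ S : Finset A, n :=
          Finset.sum_lt_sum_of_nonempty Finset.univ_nonempty fun S _ => hfib S
      _ = _ := by simp [hA]
  have : 2 ^ (D * s) * n ≤ 2 ^ (D * s) * (D * good.card) := Nat.mul_le_mul_left _ hgood_card
  nlinarith

open Classical in
/-- The tuples with at least `2 |V| / D` extensions to a member of `M`. -/
noncomputable def heavyPrefixes {V : Type*} [Fintype V] {k : ℕ} (D : ℕ)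
    (M : Finset (Fin (k + 1) → V)) : Finset (Fin k → V) :=
  Finset.univ.filter fun z => 2 * Fintype.card V ≤
    D * (Finset.univ.filter fun v => (Fin.last k).insertNth (α := fun _ => V) v z ∈ M).card

/-- Light prefixes carry at most `2 n^(k+1) / D` members of `M`, and a heavy one at most `n`. The
factor `k + 1` in the hypothesis drops to `k`, so the bound can be reapplied down the induction. -/
lemma card_heavyPrefixes_gt {V : Type*} [Fintype V] {k D : ℕ} {M : Finset (Fin (k + 1) → V)}
    (hM : 2 * (k + 1) * Fintype.card V ^ (k + 1) < D * M.card) :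
    2 * k * Fintype.card V ^ k < D * (heavyPrefixes D M).card := by
  classical
  set n := Fintype.card V with hn
  have h1 : M.card = ∑ z : Fin k → V,
      (Finset.univ.filter fun v => (Fin.last k).insertNth (α := fun _ => V) v z ∈ M).card := by
    rw [← Finset.card_sigma]
    symm
    refine Finset.card_nbij' (fun p => (Fin.last k).insertNth (α := fun _ => V) p.2 p.1)
      (fun y => ⟨(Fin.last k).removeNth y, y (Fin.last k)⟩) ?_ ?_ ?_ ?_
    · rintro ⟨z, v⟩ h
      simpa using h
    · intro y hy
      simpa using hy
    · rintro ⟨z, v⟩ h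
      simp
    · intro y hy
      simp
  have h2 : D * M.card ≤ D * (heavyPrefixes D M).card * n + n ^ k * (2 * n) := by
    rw [h1, Finset.mul_sum]
    calc _ ≤ ∑ z : Fin k → V, ((if z ∈ heavyPrefixes D M then D * n else 0) + 2 * n) := by
          refine Finset.sum_le_sum fun z _ => ?_
          split_ifs with hz
          · exact (Nat.mul_le_mul_left _ (Finset.card_le_univ _)).trans (Nat.le_add_right _ _)
          · simp only [heavyPrefixes, Finset.mem_filter, Finset.mem_univ, true_and, not_le] at hz
            omega
      _ = _ := by
        rw [Finset.sum_add_distrib, Finset.sum_ite_mem]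
        simp [hn]
        ring
  have h3 : (2 * k * n ^ k) * n < (D * (heavyPrefixes D M).card) * n := by
    have := hM.trans_le h2
    ring_nf at this ⊢
    omega
  exact lt_of_mul_lt_mul_right h3 (Nat.zero_le _)

namespace SimpleGraph

variable {V : Type*} [Fintype V] {G : SimpleGraph V}

lemma adj_of_mem_heavyPrefixes {k D : ℕ} {M : Finset (Fin (k + 1) → V)} (hV : 0 < Fintype.card V)
    (hM : ∀ y ∈ M, ∀ i j, i ≠ j → G.Adj (y i) (y j)) :
    ∀ z ∈ heavyPrefixes D M, ∀ i j, i ≠ j → G.Adj (z i) (z j) := by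
  classical
  intro z hz i j hij
  simp only [heavyPrefixes, Finset.mem_filter, Finset.mem_univ, true_and] at hz
  obtain ⟨v, hv⟩ := Finset.card_pos.1 (Nat.pos_of_mul_pos_left (lt_of_lt_of_le (by omega) hz))
  have := hM _ (Finset.mem_filter.1 hv).2 ((Fin.last k).succAbove i) ((Fin.last k).succAbove j)
    (by simpa using hij)
  simpa only [Fin.insertNth_apply_succAbove] using this

/-- The pigeonhole lemma applied to the relation "`v` extends `x a` to a member of `M`". Passing
from `D * s` tuples to `s` of them buys a common set `T` of extensions. -/
lemma exists_family_and_common_of_heavyPrefixes {k D s : ℕ} (hD : 0 < D) (hs : 0 < s)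
    {M : Finset (Fin (k + 1) → V)} {x : Fin (D * s) → Fin k → V}
    (hx : ∀ a, x a ∈ heavyPrefixes D M) (hinj : ∀ i, Function.Injective fun a => x a i)
    (hadj : ∀ a b i j, i ≠ j → G.Adj (x a i) (x b j)) :
    ∃ (x' : Fin s → Fin k → V) (T : Finset V),
      Fintype.card V ≤ D * 2 ^ (D * s) * T.card ∧
      (∀ a, ∀ v ∈ T, (Fin.last k).insertNth (α := fun _ => V) v (x' a) ∈ M) ∧
      (∀ i, Function.Injective fun a => x' a i) ∧
      ∀ a b i j, i ≠ j → G.Adj (x' a i) (x' b j) := by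
  classical
  obtain ⟨S, hS, hT⟩ := exists_card_eq_and_le_card_common
    (fun (a : Fin (D * s)) (v : V) => (Fin.last k).insertNth (α := fun _ => V) v (x a) ∈ M)
    hD hs (by simp) (fun a => by
      have := hx a
      simp only [heavyPrefixes, Finset.mem_filter, Finset.mem_univ, true_and] at this
      convert this)
  let e : Fin s ≃ S := (S.equivFinOfCardEq hS).symm
  refine ⟨fun a => x (e a), Finset.univ.filter fun v =>
    ∀ a ∈ S, (Fin.last k).insertNth (α := fun _ => V) v (x a) ∈ M, by convert hT, fun a v hv => ?_,
    fun i a b hab => ?_, fun a b i j hij => hadj _ _ _ _ hij⟩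
  · exact (Finset.mem_filter.1 hv).2 _ (e a).2
  · exact e.injective (Subtype.ext (hinj i hab))

/-- Many ordered cliques contain the transversals of a large complete multipartite subgraph. -/
lemma exists_multipartite_family {D : ℕ} (hD : 0 < D) (k : ℕ) :
    ∀ (s : ℕ) (M : Finset (Fin (k + 1) → V)), 0 < s →
      (∀ y ∈ M, ∀ i j, i ≠ j → G.Adj (y i) (y j)) →
      2 * (k + 1) * Fintype.card V ^ (k + 1) < D * M.card →
      D * 2 ^ (D ^ k * s) * (D ^ k * s) ≤ Fintype.card V →
      ∃ x : Fin s → Fin (k + 1) → V, (∀ a, x a ∈ M) ∧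
        (∀ i, Function.Injective fun a => x a i) ∧
        ∀ a b i j, i ≠ j → G.Adj (x a i) (x b j) := by
  induction k with
  | zero =>
    intro s M hs _ hM hn
    have hsM : s ≤ M.card := by
      have h1 : D * s ≤ D * 2 ^ (D ^ 0 * s) * (D ^ 0 * s) := by
        simp only [pow_zero, one_mul]
        exact Nat.mul_le_mul_right _ (Nat.le_mul_of_pos_right _ (by positivity))
      have h2 : D * s < D * M.card := by
        simp only [zero_add, mul_one, pow_one] at hM
        omega
      exact (lt_of_mul_lt_mul_left h2 (Nat.zero_le _)).le
    obtain ⟨S, hS, hc⟩ := Finset.exists_subset_card_eq hsM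
    let e : Fin s ≃ S := (S.equivFinOfCardEq hc).symm
    refine ⟨fun a => e a, fun a => hS (e a).2, fun i a b hab => ?_, fun a b i j hij => ?_⟩
    · refine e.injective (Subtype.ext (funext fun j => ?_))
      rw [Subsingleton.elim (α := Fin 1) j i]
      exact hab
    · exact absurd (Subsingleton.elim (α := Fin 1) i j) hij
  | succ k ih =>
    intro s M hs hM hcard hn
    have hnpos : 0 < Fintype.card V := lt_of_lt_of_le (by positivity) hn
    -- Each level loses a factor `D` in class size; this is the source of `D ^ k * s` in the size
    -- hypothesis.
    obtain ⟨x, hxL, hxinj, hxadj⟩ := ih (D * s) (heavyPrefixes D M) (by positivity)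
      (adj_of_mem_heavyPrefixes hnpos hM)
      (by exact_mod_cast card_heavyPrefixes_gt hcard)
      (by rwa [← mul_assoc (D ^ k), ← pow_succ])
    obtain ⟨x', T, hT, hTM, hinj, hadj⟩ :=
      exists_family_and_common_of_heavyPrefixes hD hs hxL hxinj hxadj
    have hsT : s ≤ T.card := by
      by_contra! hlt
      have h1 : D * s ≤ D ^ (k + 1) * s :=
        Nat.mul_le_mul_right _ (Nat.le_self_pow (by omega) D)
      have h2 : s ≤ D ^ (k + 1) * s := Nat.le_mul_of_pos_left _ (by positivity)
      have h3 : D * 2 ^ (D * s) * T.card < D * 2 ^ (D ^ (k + 1) * s) * (D ^ (k + 1) * s) := by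
        calc _ < D * 2 ^ (D * s) * s := Nat.mul_lt_mul_of_pos_left hlt (by positivity)
          _ ≤ _ := by gcongr; omega
      omega
    obtain ⟨T', hT', hc⟩ := Finset.exists_subset_card_eq hsT
    let e : Fin s ≃ T' := (T'.equivFinOfCardEq hc).symm
    have hmem : ∀ a b, (Fin.last (k + 1)).insertNth (α := fun _ => V) (e b : V) (x' a) ∈ M :=
      fun a b => hTM a _ (hT' (e b).2)
    refine ⟨fun a => (Fin.last (k + 1)).insertNth (α := fun _ => V) (e a : V) (x' a),
      fun a => hmem a a, ?_, ?_⟩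
    · rw [Fin.forall_iff_succAbove (Fin.last (k + 1))]
      refine ⟨fun a b hab => ?_, fun i a b hab => ?_⟩
      · simp only [Fin.insertNth_apply_same] at hab
        exact e.injective (Subtype.ext hab)
      · simp only [Fin.insertNth_apply_succAbove] at hab
        exact hinj i hab
    · have hcross : ∀ a b i, G.Adj (x' a i) (e b) := by
        intro a b i
        have := hM _ (hmem a b) ((Fin.last (k + 1)).succAbove i) (Fin.last (k + 1))
          (Fin.succAbove_ne _ _)
        simpa only [Fin.insertNth_apply_succAbove, Fin.insertNth_apply_same] using this
      intro a b
      simp only [Fin.forall_iff_succAbove (Fin.last (k + 1)), Fin.insertNth_apply_same,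
        Fin.insertNth_apply_succAbove]
      refine ⟨⟨fun h => absurd rfl h, fun i _ => (hcross b a i).symm⟩, fun i =>
        ⟨fun _ => hcross a b i, fun j hij => hadj a b i j fun h => hij (by rw [h])⟩⟩

/-- Many ordered `(k + 1)`-cliques force a complete `(k + 1)`-partite subgraph with `k` small
classes and one large class. -/
lemma isContained_of_card_cliqueTuples {D k s t : ℕ} (hD : 0 < D) (hk : 0 < k) (hs : 0 < s)
    (hcard : 2 * (k + 1) * Fintype.card V ^ (k + 1) <
      D * (G.cliqueTuples Finset.univ (k + 1)).card)
    (hn : D * 2 ^ (D ^ k * s) * (D ^ k * s) ≤ Fintype.card V)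
    (ht : ∀ m : ℕ, Fintype.card V ≤ D * 2 ^ (D * s) * m → t ≤ m) :
    completePartiteGraph (lastClassSizes (k + 1) s t) ⊑ G := by
  obtain ⟨p, rfl⟩ : ∃ p, k = p + 1 := ⟨k - 1, by omega⟩
  have hnpos : 0 < Fintype.card V := lt_of_lt_of_le (by positivity) hn
  set M := G.cliqueTuples Finset.univ (p + 1 + 1)
  have hM : ∀ y ∈ M, ∀ i j, i ≠ j → G.Adj (y i) (y j) := fun y hy => (mem_cliqueTuples.1 hy).2
  classical
  -- Only the first `p + 1` classes come from the induction. The last class is cut from the whole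
  -- common extension set `T`, which is much larger than `s`.
  obtain ⟨x, hxL, hxinj, hxadj⟩ := exists_multipartite_family (G := G) hD p (D * s)
    (heavyPrefixes D M) (by positivity)
    (adj_of_mem_heavyPrefixes hnpos hM)
    (by exact_mod_cast card_heavyPrefixes_gt hcard)
    (by rwa [← mul_assoc (D ^ p), ← pow_succ])
  obtain ⟨x', T, hT, hTM, hinj, hadj⟩ :=
    exists_family_and_common_of_heavyPrefixes hD hs hxL hxinj hxadj
  obtain ⟨T', hT', hc⟩ := Finset.exists_subset_card_eq (ht _ hT)
  let e : Fin t ≃ T' := (T'.equivFinOfCardEq hc).symm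
  have hcross : ∀ a b i, G.Adj (x' a i) (e b) := by
    intro a b i
    have := hM _ (hTM a _ (hT' (e b).2)) ((Fin.last (p + 1)).succAbove i) (Fin.last (p + 1))
      (Fin.succAbove_ne _ _)
    simpa only [Fin.insertNth_apply_succAbove, Fin.insertNth_apply_same] using this
  have hlast : ∀ i : Fin (p + 1 + 1), (i : ℕ) + 1 = p + 1 + 1 →
      lastClassSizes (p + 1 + 1) s t i = t := fun i hi => by simp [lastClassSizes, hi]
  have hinit : ∀ i : Fin (p + 1 + 1), ¬ (i : ℕ) + 1 = p + 1 + 1 →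
      lastClassSizes (p + 1 + 1) s t i = s := fun i hi => by
    rw [lastClassSizes, if_neg hi]
  let f : (Σ i : Fin (p + 1 + 1), Fin (lastClassSizes (p + 1 + 1) s t i)) → V := fun u =>
    if h : (u.1 : ℕ) + 1 = p + 1 + 1 then (e (Fin.cast (hlast _ h) u.2) : V)
    else x' (Fin.cast (hinit _ h) u.2) ⟨u.1, by omega⟩
  have hf : ∀ u v, u.1 ≠ v.1 → G.Adj (f u) (f v) := by
    intro u v huv
    have huv' : (u.1 : ℕ) ≠ v.1 := fun h => huv (Fin.ext h)
    simp only [f]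
    split_ifs with h1 h2 h2
    · omega
    · exact (hcross _ _ _).symm
    · exact hcross _ _ _
    · exact hadj _ _ _ _ (by simpa using huv')
  refine ⟨⟨⟨f, fun {u v} huv => hf u v huv⟩, fun u v huv => ?_⟩⟩
  change f u = f v at huv
  by_cases hne : u.1 = v.1
  · obtain ⟨i, a⟩ := u
    obtain ⟨j, b⟩ := v
    obtain rfl : i = j := hne
    by_cases h : (i : ℕ) + 1 = p + 1 + 1
    · simp only [f, dif_pos h] at huv
      have := e.injective (Subtype.ext huv)
      rw [Fin.cast_inj] at this
      rw [this]
    · simp only [f, dif_neg h] at huv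
      have := hinj _ huv
      rw [Fin.cast_inj] at this
      rw [this]
  · exact absurd huv (hf u v hne).ne

end SimpleGraph

/-! ### Light edges and vertices of low degree -/

namespace SimpleGraph

lemma commonNeighborsIn_mono {V : Type*} {G H : SimpleGraph V} {S T : Finset V} (hGH : G ≤ H)
    (hST : S ⊆ T) {k : ℕ} (y : Fin k → V) : G.commonNeighborsIn S y ⊆ H.commonNeighborsIn T y := fun v hv => by
  rw [mem_commonNeighborsIn] at hv ⊢
  exact ⟨hST hv.1, fun i => hGH (hv.2 i)⟩

variable {V : Type*} [Fintype V]

lemma cliqueTuples_mono {G H : SimpleGraph V} {S T : Finset V} (hGH : G ≤ H) (hST : S ⊆ T) (k : ℕ) :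
    G.cliqueTuples S k ⊆ H.cliqueTuples T k := fun y hy => by
  rw [mem_cliqueTuples] at hy ⊢
  exact ⟨fun i => hST (hy.1 i), fun i j hij => hGH (hy.2 i j hij)⟩

/-- The number of ordered `p`-cliques in the common neighbourhood of `u` and `v`. -/
noncomputable def jointSize (G : SimpleGraph V) (p : ℕ) (u v : V) : ℕ :=
  (G.cliqueTuples (G.commonNeighborsIn Finset.univ ![u, v]) p).card

lemma jointSize_comm (G : SimpleGraph V) (p : ℕ) (u v : V) :
    G.jointSize p u v = G.jointSize p v u := by
  unfold jointSize
  congr 2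
  ext w
  simp [mem_commonNeighborsIn, Fin.forall_fin_two, and_comm]

lemma jointSize_mono {G H : SimpleGraph V} (hGH : G ≤ H) (p : ℕ) (u v : V) :
    G.jointSize p u v ≤ H.jointSize p u v :=
  Finset.card_le_card (cliqueTuples_mono hGH (commonNeighborsIn_mono hGH (Finset.Subset.refl _) _) p)

/-- The edges of `G` that lie in few ordered `(p + 2)`-cliques. -/
def lightSubgraph (G : SimpleGraph V) (p : ℕ) (d : ℝ) : SimpleGraph V where
  Adj u v := G.Adj u v ∧ (G.jointSize p u v : ℝ) < d
  symm := ⟨fun u v h => ⟨h.1.symm, by rw [jointSize_comm]; exact h.2⟩⟩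
  loopless := ⟨fun u h => G.irrefl h.1⟩

lemma lightSubgraph_le (G : SimpleGraph V) (p : ℕ) (d : ℝ) : G.lightSubgraph p d ≤ G :=
  fun _ _ h => h.1

open Classical in
/-- The ordered pairs of adjacent vertices. -/
noncomputable def adjPairs (G : SimpleGraph V) : Finset (V × V) :=
  Finset.univ.filter fun e => G.Adj e.1 e.2

lemma mem_adjPairs {G : SimpleGraph V} {e : V × V} : e ∈ G.adjPairs ↔ G.Adj e.1 e.2 := by
  simp [adjPairs]

lemma card_adjPairs (G : SimpleGraph V) : G.adjPairs.card = 2 * G.edgeSet.ncard := by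
  classical
  rw [Set.ncard_eq_toFinset_card', ← edgeFinset, ← sum_degrees_eq_twice_card_edges, adjPairs,
    Finset.card_filter, ← Finset.univ_product_univ, Finset.sum_product]
  refine Finset.sum_congr rfl fun v _ => ?_
  rw [← Finset.card_filter, degree, neighborFinset_eq_filter]

open Classical in
lemma card_cliqueTuples_two (G : SimpleGraph V) (S : Finset V) :
    (G.cliqueTuples S 2).card = (G.adjPairs.filter fun e => e.1 ∈ S ∧ e.2 ∈ S).card := by
  refine Finset.card_nbij' (fun y => (y 0, y 1)) (fun e => ![e.1, e.2]) ?_ ?_ ?_ ?_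
  · intro y hy
    have := mem_cliqueTuples.1 (Finset.mem_coe.1 hy)
    simpa [mem_adjPairs] using ⟨this.2 0 1 (by simp), this.1 0, this.1 1⟩
  · rintro ⟨u, v⟩ h
    simp only [Finset.coe_filter, mem_adjPairs, Set.mem_ofPred_eq] at h
    simp [mem_cliqueTuples, Fin.forall_fin_two, h.1, h.1.symm, h.2]
  · intro y _
    ext i
    fin_cases i <;> rfl
  · intro e _
    rfl

/-- Deleting the edges in many ordered cliques deletes few edges. -/
lemma mul_card_adjPairs_sdiff_lightSubgraph_le (G : SimpleGraph V) (p : ℕ) {d : ℝ} :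
    d * ((G \ G.lightSubgraph p d).adjPairs.card : ℝ) ≤
      ((G.cliqueTuples Finset.univ (p + 2)).card : ℝ) := by
  have h1 : ∑ e ∈ (G \ G.lightSubgraph p d).adjPairs, G.jointSize p e.1 e.2 ≤
      (G.cliqueTuples Finset.univ (p + 2)).card := by
    simp only [jointSize]
    rw [← Finset.card_sigma]
    -- A deleted ordered edge followed by an ordered `p`-clique in its joint neighbourhood is an
    -- ordered `(p + 2)`-clique.
    refine Finset.card_le_card_of_injOn
      (fun x => Fin.cons (α := fun _ => V) x.1.1 (Fin.cons (α := fun _ => V) x.1.2 x.2)) ?_ ?_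
    · rintro ⟨⟨u, v⟩, y⟩ h
      simp only [Finset.coe_sigma, Set.mem_sigma_iff, Finset.mem_coe, mem_adjPairs, sdiff_adj,
        mem_cliqueTuples, mem_commonNeighborsIn, Fin.forall_fin_two, Finset.mem_univ, true_and,
        Matrix.cons_val_zero, Matrix.cons_val_one] at h
      obtain ⟨⟨huv, -⟩, hy, hyy⟩ := h
      rw [Finset.mem_coe, mem_cliqueTuples]
      refine ⟨fun _ => Finset.mem_univ _, ?_⟩
      simp only [Fin.forall_fin_succ (n := p + 1), Fin.forall_fin_succ (n := p), Fin.cons_zero,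
        Fin.cons_succ]
      refine ⟨⟨fun h => absurd rfl h, fun _ => huv, fun i _ => (hy i).1.symm⟩,
        ⟨fun _ => huv.symm, fun h => absurd rfl h, fun i _ => (hy i).2.symm⟩,
        fun i => ⟨fun _ => (hy i).1, fun _ => (hy i).2, fun j hij => hyy i j fun h => hij (by rw [h])⟩⟩
    · rintro ⟨⟨u, v⟩, y⟩ - ⟨⟨u', v'⟩, y'⟩ - h
      simp only [Fin.cons_inj] at h
      obtain ⟨rfl, rfl, rfl⟩ := h
      rfl
  calc _ = ∑ e ∈ (G \ G.lightSubgraph p d).adjPairs, d := by simp [mul_comm]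
    _ ≤ ∑ e ∈ (G \ G.lightSubgraph p d).adjPairs, (G.jointSize p e.1 e.2 : ℝ) := by
        refine Finset.sum_le_sum fun e he => ?_
        rw [mem_adjPairs, sdiff_adj] at he
        exact not_lt.1 fun h => he.2 ⟨he.1, h⟩
    _ ≤ _ := by exact_mod_cast h1

open Classical in
lemma card_adjPairs_le_add_sum (G : SimpleGraph V) (U : Finset V) :
    G.adjPairs.card ≤ (G.cliqueTuples Uᶜ 2).card +
      2 * ∑ u ∈ U, (Finset.univ.filter fun v => G.Adj u v).card := by
  have h1 : ∑ u ∈ U, (Finset.univ.filter fun v => G.Adj u v).card =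
      (G.adjPairs.filter fun e => e.1 ∈ U).card := by
    rw [← Finset.card_sigma]
    refine Finset.card_nbij' (fun x => (x.1, x.2)) (fun e => ⟨e.1, e.2⟩) ?_ ?_ ?_ ?_
    · rintro ⟨u, v⟩ h
      simpa [mem_adjPairs, and_comm] using h
    · rintro ⟨u, v⟩ h
      simpa [mem_adjPairs, and_comm] using h
    · rintro ⟨u, v⟩ _; rfl
    · rintro ⟨u, v⟩ _; rfl
  have h2 : (G.adjPairs.filter fun e => e.2 ∈ U).card =
      (G.adjPairs.filter fun e => e.1 ∈ U).card := by
    refine Finset.card_nbij' Prod.swap Prod.swap ?_ ?_ ?_ ?_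
    · rintro ⟨u, v⟩ h
      simpa [mem_adjPairs, G.adj_comm] using h
    · rintro ⟨u, v⟩ h
      simpa [mem_adjPairs, G.adj_comm] using h
    · rintro ⟨u, v⟩ _; rfl
    · rintro ⟨u, v⟩ _; rfl
  rw [h1, card_cliqueTuples_two]
  have h3 : G.adjPairs ⊆ (G.adjPairs.filter fun e => e.1 ∈ Uᶜ ∧ e.2 ∈ Uᶜ) ∪
      ((G.adjPairs.filter fun e => e.1 ∈ U) ∪ G.adjPairs.filter fun e => e.2 ∈ U) := by
    intro e he
    simp only [Finset.mem_union, Finset.mem_filter, he, true_and, Finset.mem_compl]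
    tauto
  have h4 := Finset.card_le_card h3
  have h5 := Finset.card_union_le (G.adjPairs.filter fun e => e.1 ∈ Uᶜ ∧ e.2 ∈ Uᶜ)
    ((G.adjPairs.filter fun e => e.1 ∈ U) ∪ G.adjPairs.filter fun e => e.2 ∈ U)
  have h6 := Finset.card_union_le (G.adjPairs.filter fun e => e.1 ∈ U)
    (G.adjPairs.filter fun e => e.2 ∈ U)
  omega

/-- Deleting `u ≈ σn` vertices of degree at most `(1-w-σ)n` raises the density above `1 - w` by
`σ²/2`. At `u = σn` the gain `2uσn - (1-w)u²` equals `(1+w)σ²n²`; the surplus `wσ²n²` absorbs the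
rounding of `u`, and half of the rest pays for `α`. -/
lemma density_bound_after_deletion {n u w σ α : ℝ} (hw0 : 0 ≤ w) (hw1 : w ≤ 1) (hσ : 0 ≤ σ)
    (hn : 0 ≤ n) (hu : 0 ≤ u) (hu1 : σ * n ≤ u) (hu2 : u ≤ σ * n + 1) (hun : u ≤ n)
    (hw : 1 ≤ w * (σ * n)) (hα : 2 * α ≤ σ ^ 2) :
    (1 - w + σ ^ 2 / 2) * (n - u) ^ 2 ≤ (1 - w - α) * n ^ 2 - 2 * (u * ((1 - w - σ) * n)) := by
  have h2 : σ ^ 2 / 2 * (n - u) ^ 2 ≤ σ ^ 2 / 2 * n ^ 2 := by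
    have : 0 ≤ n - u := by linarith
    gcongr
    linarith
  have h3 : σ ^ 2 * n ^ 2 ≤ 2 * u * σ * n - (1 - w) * u ^ 2 := by
    have h4 : (1 - w) * u ≤ σ * n := by
      have h5 : (1 - w) * u ≤ (1 - w) * (σ * n + 1) :=
        mul_le_mul_of_nonneg_left hu2 (by linarith)
      linarith
    have h7 : σ * n * (σ * n) ≤ u * (σ * n) := mul_le_mul_of_nonneg_right hu1 (by positivity)
    have h8 : u * ((1 - w) * u) ≤ u * (σ * n) := mul_le_mul_of_nonneg_left h4 hu
    linarith
  have h9 : 2 * α * n ^ 2 ≤ σ ^ 2 * n ^ 2 := by gcongr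
  linarith

open Classical in
/-- A graph of nearly Turán density with few ordered `(r + 1)`-cliques has few vertices of low
degree. -/
lemma card_lt_of_forall_degree_lt (G : SimpleGraph V) {r : ℕ} (hr : 2 ≤ r) {σ α β : ℝ}
    (hσ : 0 < σ) (hσr : 32 * (r : ℝ) ^ 5 * σ ≤ 1) (hσn : (r : ℝ) ≤ σ * Fintype.card V)
    (hα : 2 * α ≤ σ ^ 2) (hβ : 4 * β * (r : ℝ) ^ r ≤ σ ^ 2)
    (hG : (1 - 1 / r - α) * (Fintype.card V : ℝ) ^ 2 ≤ G.adjPairs.card)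
    (hK : ((G.cliqueTuples Finset.univ (r + 1)).card : ℝ) < β * (Fintype.card V : ℝ) ^ (r + 1))
    {U : Finset V}
    (hU : ∀ u ∈ U, ((Finset.univ.filter fun v => G.Adj u v).card : ℝ) ≤
      (1 - 1 / r - σ) * Fintype.card V) :
    (U.card : ℝ) < σ * Fintype.card V := by
  by_contra! hcon
  set n : ℝ := (Fintype.card V : ℝ) with hn
  have hr2 : (2 : ℝ) ≤ r := by exact_mod_cast hr
  have hr5 : (r : ℝ) * r ≤ (r : ℝ) ^ 5 := by
    rw [← sq]; exact pow_le_pow_right₀ (by linarith) (by norm_num)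
  have hσ1 : 32 * (r * r * σ) ≤ 1 := by nlinarith
  have hσ2 : 64 * (r * σ) ≤ 1 := by nlinarith [mul_pos hσ (by linarith : (0 : ℝ) < r)]
  have hσ3 : 128 * σ ≤ 1 := by nlinarith
  have hn0 : 0 < n := by
    by_contra! h
    nlinarith
  -- Exactly `⌈σn⌉` vertices are removed, so that nearly all of the graph survives.
  obtain ⟨U', hU', hc⟩ := Finset.exists_subset_card_eq (Nat.ceil_le.2 hcon)
  have hc1 : σ * n ≤ (U'.card : ℝ) := by rw [hc]; exact Nat.le_ceil _
  have hc2 : (U'.card : ℝ) ≤ σ * n + 1 := by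
    rw [hc]; exact (Nat.ceil_lt_add_one (by positivity)).le
  have hm : ((U'ᶜ).card : ℝ) = n - U'.card := by
    rw [Finset.card_compl, Nat.cast_sub (Finset.card_le_univ _)]
  have hsum : ((∑ u ∈ U', (Finset.univ.filter fun v => G.Adj u v).card : ℕ) : ℝ) ≤
      U'.card * ((1 - 1 / r - σ) * n) := by
    push_cast
    rw [← nsmul_eq_mul]
    exact Finset.sum_le_card_nsmul _ _ _ fun u hu => hU u (hU' hu)
  have hpairs : (G.adjPairs.card : ℝ) ≤ (G.cliqueTuples U'ᶜ 2).card +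
      2 * ((∑ u ∈ U', (Finset.univ.filter fun v => G.Adj u v).card : ℕ) : ℝ) := by
    exact_mod_cast G.card_adjPairs_le_add_sum U'
  set u : ℝ := (U'.card : ℝ)
  set w : ℝ := 1 / (r : ℝ) with hw
  have hrw : r * w = 1 := by rw [hw]; field_simp
  have hw0 : 0 < w := by positivity
  have hw1 : w ≤ 1 / 2 := by rw [hw]; gcongr
  have hP : 128 * (σ * n) ≤ n := by
    have := mul_le_mul_of_nonneg_right hσ3 hn0.le
    linarith
  have hwn : 1 ≤ w * (σ * n) := by
    have := mul_le_mul_of_nonneg_left hσn hw0.le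
    linarith
  have hun : u ≤ 2 * (σ * n) := by linarith
  have hσw : σ ^ 2 / 2 ≤ w := by
    have h1 := mul_le_mul_of_nonneg_left hσ2 hw0.le
    have h2 : w * (64 * (r * σ)) = 64 * σ := by linear_combination 64 * σ * hrw
    have h3 : σ ^ 2 ≤ σ := by nlinarith only [hσ, hσ3]
    linarith
  have hdens : (1 - w + σ ^ 2 / 2) * ((U'ᶜ).card : ℝ) ^ 2 ≤ (G.cliqueTuples U'ᶜ 2).card := by
    rw [hm]
    have h1 : (1 - w - α) * n ^ 2 - 2 * (u * ((1 - w - σ) * n)) ≤ (G.cliqueTuples U'ᶜ 2).card := by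
      linarith
    refine le_trans ?_ h1
    exact density_bound_after_deletion hw0.le (by linarith) hσ.le hn0.le (by positivity) hc1 hc2
      (by linarith) hwn hα
  have hcl := card_cliqueTuples_ge_of_density (G := G) (S := U'ᶜ) (by omega : 1 ≤ r)
    (by positivity : 0 ≤ σ ^ 2 / 2) hσw hdens
  have hcl' : ((G.cliqueTuples U'ᶜ (r + 1)).card : ℝ) ≤ (G.cliqueTuples Finset.univ (r + 1)).card :=
    by exact_mod_cast Finset.card_le_card (cliqueTuples_mono le_rfl (Finset.subset_univ _) _)
  -- Bernoulli's inequality: at least `(1 - 2σ)n` vertices remain.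
  have hpow : n ^ (r + 1) / 2 ≤ ((U'ᶜ).card : ℝ) ^ (r + 1) := by
    have h1 : n * (1 + -(2 * σ)) ≤ ((U'ᶜ).card : ℝ) := by rw [hm]; linarith
    have h2 : 1 + ((r + 1 : ℕ) : ℝ) * (-(2 * σ)) ≤ (1 + -(2 * σ)) ^ (r + 1) :=
      one_add_mul_le_pow (by linarith) _
    calc n ^ (r + 1) / 2 = n ^ (r + 1) * (1 / 2) := by ring
      _ ≤ n ^ (r + 1) * (1 + -(2 * σ)) ^ (r + 1) := by
          gcongr
          refine le_trans ?_ h2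
          push_cast
          linarith
      _ = (n * (1 + -(2 * σ))) ^ (r + 1) := by rw [mul_pow]
      _ ≤ _ := by
          have : 0 ≤ n * (1 + -(2 * σ)) := mul_nonneg hn0.le (by linarith)
          gcongr
  have hrr : (0 : ℝ) < (r : ℝ) ^ r := by positivity
  have hfin : β * n ^ (r + 1) ≤ σ ^ 2 / 2 * ((U'ᶜ).card : ℝ) ^ (r + 1) / (r : ℝ) ^ r := by
    rw [le_div_iff₀ hrr]
    calc β * n ^ (r + 1) * (r : ℝ) ^ r = (4 * β * (r : ℝ) ^ r) * (n ^ (r + 1) / 4) := by ring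
      _ ≤ σ ^ 2 * (n ^ (r + 1) / 4) := by gcongr
      _ = σ ^ 2 / 2 * (n ^ (r + 1) / 2) := by ring
      _ ≤ _ := by gcongr
  linarith

/-! ### Vertices of large degree: no `(r + 1)`-clique, hence an `r`-colouring -/

lemma card_le_card_commonNeighborsIn_add (G : SimpleGraph V) {S : Finset V} {m : ℝ}
    (hS : ∀ v ∈ S, (Fintype.card V : ℝ) - m ≤ (G.commonNeighborsIn Finset.univ ![v]).card)
    {k : ℕ} {y : Fin k → V} (hy : ∀ i, y i ∈ S) :
    (S.card : ℝ) - k * m ≤ (G.commonNeighborsIn S y).card := by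
  classical
  have h1 : S ⊆ G.commonNeighborsIn S y ∪
      Finset.univ.biUnion fun i => (G.commonNeighborsIn Finset.univ ![y i])ᶜ := by
    intro v hv
    simp only [Finset.mem_union, mem_commonNeighborsIn, Finset.mem_biUnion, Finset.mem_compl,
      Finset.mem_univ, true_and, hv]
    by_cases h : ∀ i, G.Adj v (y i)
    · exact Or.inl h
    · push Not at h
      obtain ⟨i, hi⟩ := h
      exact Or.inr ⟨i, fun h => hi (by simpa using h 0)⟩
  have h2 : (S.card : ℝ) ≤ (G.commonNeighborsIn S y).card +
      ∑ i : Fin k, (((G.commonNeighborsIn Finset.univ ![y i])ᶜ).card : ℝ) := by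
    exact_mod_cast (Finset.card_le_card h1).trans ((Finset.card_union_le _ _).trans
      (Nat.add_le_add_left Finset.card_biUnion_le _))
  have h3 : ∑ i : Fin k, (((G.commonNeighborsIn Finset.univ ![y i])ᶜ).card : ℝ) ≤ k * m := by
    calc _ ≤ ∑ i : Fin k, m := by
          refine Finset.sum_le_sum fun i _ => ?_
          rw [Finset.card_compl, Nat.cast_sub (Finset.card_le_univ _)]
          linarith [hS _ (hy i)]
      _ = _ := by simp
  linarith

lemma mul_card_cliqueTuples_le_succ (G : SimpleGraph V) {S : Finset V} {k : ℕ} {q : ℝ}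
    (h : ∀ y ∈ G.cliqueTuples S k, q ≤ (G.commonNeighborsIn S y).card) :
    q * (G.cliqueTuples S k).card ≤ (G.cliqueTuples S (k + 1)).card := by
  rw [card_cliqueTuples_succ]
  push_cast
  rw [mul_comm, ← nsmul_eq_mul]
  exact Finset.card_nsmul_le_sum _ _ _ h

/-- Greedy lower bound for the number of ordered cliques in a set of vertices of large degree. -/
lemma card_cliqueTuples_ge_of_degree (G : SimpleGraph V) {S : Finset V} {m a b : ℝ}
    (hS : ∀ v ∈ S, (Fintype.card V : ℝ) - m ≤ (G.commonNeighborsIn Finset.univ ![v]).card)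
    (ha : 0 ≤ a) (hb : 0 ≤ b) {p : ℕ} (h1 : ∀ k : ℕ, k < p → a ≤ S.card - k * m)
    (h2 : b ≤ S.card - p * m) :
    b * a ^ p ≤ (G.cliqueTuples S (p + 1)).card := by
  have key : ∀ k : ℕ, k ≤ p → a ^ k ≤ (G.cliqueTuples S k).card := by
    intro k
    induction k with
    | zero => intro _; simp [card_cliqueTuples_zero]
    | succ k ih =>
      intro hk
      refine le_trans ?_ (mul_card_cliqueTuples_le_succ G (q := a) fun y hy =>
        (h1 k (by omega)).trans
        (card_le_card_commonNeighborsIn_add G hS (mem_cliqueTuples.1 hy).1))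
      rw [pow_succ']
      exact mul_le_mul_of_nonneg_left (ih (by omega)) ha
  refine le_trans (mul_le_mul_of_nonneg_left (key p le_rfl) hb)
    (mul_card_cliqueTuples_le_succ G fun y hy => h2.trans
      (card_le_card_commonNeighborsIn_add G hS (mem_cliqueTuples.1 hy).1))

/-- Among `r + 1` vertices of large degree, two have many common neighbours. -/
lemma exists_card_commonNeighborsIn_ge (G : SimpleGraph V) {r : ℕ} (hr : 1 ≤ r)
    {x : Fin (r + 1) → V} {d κ : ℝ}
    (hd : ∀ i, d ≤ (G.commonNeighborsIn Finset.univ ![x i]).card)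
    (hκ : r * (r + 1) * κ ≤ 2 * (r - 1) * (r + 1) * d - r * (r - 1) * Fintype.card V) :
    ∃ i j, i ≠ j ∧ κ ≤ (G.commonNeighborsIn Finset.univ ![x i, x j]).card := by
  classical
  by_contra! hcon
  let a : Fin (r + 1) → V → ℝ := fun i v => if G.Adj v (x i) then 1 else 0
  have haa : ∀ i v, a i v * a i v = a i v := fun i v => by simp [a]
  have hdeg : ∀ i, ((G.commonNeighborsIn Finset.univ ![x i]).card : ℝ) = ∑ v, a i v := fun i => by
    simp [commonNeighborsIn, a]
  have hcod : ∀ i j, ((G.commonNeighborsIn Finset.univ ![x i, x j]).card : ℝ) =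
      ∑ v, a i v * a j v := fun i j => by
    simp only [commonNeighborsIn, a, Finset.card_filter, Fin.forall_fin_two]
    push_cast
    refine Finset.sum_congr rfl fun v _ => ?_
    by_cases h1 : G.Adj v (x i) <;> by_cases h2 : G.Adj v (x j) <;> simp [h1, h2]
  have hr0 : (0 : ℝ) ≤ r - 1 := by
    have : (1 : ℝ) ≤ r := by exact_mod_cast hr
    linarith
  have hsq : ∑ i, ∑ j, ∑ v, a i v * a j v = ∑ v, (∑ i, a i v) ^ 2 := by
    simp only [sq, Finset.sum_mul_sum]
    rw [Finset.sum_comm (s := (Finset.univ : Finset V))]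
    exact Finset.sum_congr rfl fun i _ => Finset.sum_comm
  have hnat : ∀ v, ∃ k : ℕ, ∑ i, a i v = k := fun v =>
    ⟨(Finset.univ.filter fun i => G.Adj v (x i)).card, by simp [a]⟩
  -- The number `k` of the `x i` adjacent to `v` is an integer, so `(k - r)(k - r + 1) ≥ 0`. Summing
  -- over `v` bounds the second moment below; its off-diagonal part is the sum of the codegrees.
  have hpt : ∀ v, (2 * (r : ℝ) - 1) * (∑ i, a i v) - r * (r - 1) ≤ (∑ i, a i v) ^ 2 := by
    intro v
    obtain ⟨k, hk⟩ := hnat v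
    rw [hk]
    have : (0 : ℝ) ≤ ((k : ℝ) - r) * (k - r + 1) := by
      rcases le_or_gt r k with h | h
      · have : (r : ℝ) ≤ k := by exact_mod_cast h
        exact mul_nonneg (by linarith) (by linarith)
      · have : (k : ℝ) + 1 ≤ r := by exact_mod_cast h
        exact mul_nonneg_of_nonpos_of_nonpos (by linarith) (by linarith)
    nlinarith
  have hlow : (2 * (r : ℝ) - 1) * ∑ i, ∑ v, a i v - r * (r - 1) * Fintype.card V ≤
      ∑ v, (∑ i, a i v) ^ 2 := by
    rw [show ∑ i, ∑ v, a i v = ∑ v, ∑ i, a i v from Finset.sum_comm, Finset.mul_sum]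
    have := Finset.sum_le_sum fun v (_ : v ∈ Finset.univ) => hpt v
    rw [Finset.sum_sub_distrib] at this
    simpa [mul_comm] using this
  have hup : ∑ i, ∑ j, ∑ v, a i v * a j v < ∑ i : Fin (r + 1), (∑ v, a i v + r * κ) := by
    refine Finset.sum_lt_sum_of_nonempty Finset.univ_nonempty fun i _ => ?_
    rw [← Finset.add_sum_erase _ _ (Finset.mem_univ i)]
    simp only [haa]
    have h1 : ∑ j ∈ Finset.univ.erase i, ∑ v, a i v * a j v <
        ∑ j ∈ (Finset.univ : Finset (Fin (r + 1))).erase i, κ := by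
      refine Finset.sum_lt_sum_of_nonempty ?_ fun j hj => ?_
      · rw [← Finset.card_pos, Finset.card_erase_of_mem (Finset.mem_univ i)]
        simp
        omega
      · rw [← hcod]
        exact hcon i j (Finset.ne_of_mem_erase hj).symm
    have h2 : ∑ j ∈ (Finset.univ : Finset (Fin (r + 1))).erase i, κ = r * κ := by
      simp [Finset.card_erase_of_mem]
    linarith
  have hsumdeg : (r + 1) * d ≤ ∑ i, ∑ v, a i v := by
    have := Finset.sum_le_sum fun i (_ : i ∈ Finset.univ) => (hd i).trans (hdeg i).le
    simpa using this
  rw [Finset.sum_add_distrib] at hup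
  simp only [Finset.sum_const, Finset.card_univ, Fintype.card_fin, nsmul_eq_mul] at hup
  push_cast at hup
  have h3 := mul_le_mul_of_nonneg_left hsumdeg (mul_nonneg (zero_le_two (α := ℝ)) hr0)
  nlinarith

open Classical in
/-- If the non-exceptional vertices have large degree and every edge lies in few ordered
`(r + 1)`-cliques, then there is no `(r + 1)`-clique avoiding the exceptional vertices. -/
lemma cliqueTuples_compl_eq_empty (G : SimpleGraph V) {p : ℕ} {σ : ℝ} {U : Finset V}
    (hσr : 32 * ((p + 2 : ℕ) : ℝ) ^ 5 * σ ≤ 1) (hσ : 0 < σ) (hn : 0 < Fintype.card V)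
    (hU : (U.card : ℝ) ≤ σ * Fintype.card V)
    (hdeg : ∀ v ∉ U, (1 - 1 / ((p + 2 : ℕ) : ℝ) - σ) * Fintype.card V ≤
      (G.commonNeighborsIn Finset.univ ![v]).card)
    (hjoint : ∀ u v, G.Adj u v →
      (G.jointSize (p + 1) u v : ℝ) < (Fintype.card V : ℝ) ^ (p + 1) / ((p + 2 : ℕ) : ℝ) ^ (p + 4)) :
    G.cliqueTuples Uᶜ (p + 3) = ∅ := by
  rw [Finset.eq_empty_iff_forall_notMem]
  intro x hx
  obtain ⟨hxU, hxadj⟩ := mem_cliqueTuples.1 hx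
  set n : ℝ := (Fintype.card V : ℝ) with hn'
  set r : ℝ := ((p + 2 : ℕ) : ℝ) with hr'
  have hrp : r = p + 2 := by rw [hr']; push_cast; ring
  have hn0 : 0 < n := Nat.cast_pos.2 hn
  have hp0 : (0 : ℝ) ≤ p := by positivity
  have hr2 : 2 ≤ r := by linarith
  have hr0 : 0 < r := by linarith
  set w : ℝ := 1 / r with hw
  have hrw : r * w = 1 := by rw [hw]; field_simp
  have hw0 : 0 < w := by positivity
  have hw1 : w ≤ 1 / 2 := by rw [hw]; gcongr
  have hσw : 32 * σ ≤ w ^ 5 := by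
    rw [hw, one_div_pow, le_div_iff₀ (by positivity)]
    linarith
  have hσ4 : 64 * σ ≤ w ^ 4 := by
    have : w ^ 5 ≤ w ^ 4 * (1 / 2) := by rw [pow_succ]; gcongr
    linarith
  have hrσ : 64 * (r * σ) ≤ w ^ 3 := by
    have h1 := mul_le_mul_of_nonneg_left hσ4 hr0.le
    have h2 : r * w ^ 4 = w ^ 3 := by linear_combination w ^ 3 * hrw
    linarith
  have hσ3 : σ ≤ r * σ := by nlinarith
  -- Two degrees alone would give a codegree of only `(1 - 2w - 2σ)n`. Averaging over all `r + 1`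
  -- vertices gains the term `w ^ 3`, on which the last greedy step depends.
  obtain ⟨i, j, hij, hW⟩ := G.exists_card_commonNeighborsIn_ge (r := p + 2) (by omega) (x := x)
    (d := (1 - w - σ) * n) (κ := (1 - 2 * w + w ^ 3) * n)
    (fun i => hdeg _ (Finset.mem_compl.1 (hxU i))) (by
      have hmain : r * (r + 1) * (1 - 2 * w + w ^ 3) ≤
          2 * (r - 1) * (r + 1) * (1 - w - σ) - r * (r - 1) := by
        have e1 : 2 * (r - 1) * (r + 1) * (1 - w - σ) - r * (r - 1) -
            r * (r + 1) * (1 - 2 * w + w ^ 3) =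
            w - w ^ 2 - 2 * ((r ^ 2 - 1) * σ) := by
          linear_combination (2 - w * (r * w + 1) - w ^ 2) * hrw
        have e2 : r ^ 2 * σ ≤ w ^ 2 / 64 := by
          have h1 := mul_le_mul_of_nonneg_left hrσ hr0.le
          have h2 : r * w ^ 3 = w ^ 2 := by linear_combination w ^ 2 * hrw
          linarith
        have e3 : w ^ 2 ≤ w * (1 / 2) := by rw [sq]; gcongr
        linarith
      have := mul_le_mul_of_nonneg_right hmain hn0.le
      rw [← hr', ← hn']
      linarith)
  refine absurd (hjoint _ _ (hxadj i j hij)) (not_lt.2 ?_)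
  set W := G.commonNeighborsIn Finset.univ ![x i, x j] with hWdef
  have hcardS : (1 - 2 * w + w ^ 3 - σ) * n ≤ ((W \ U).card : ℝ) := by
    have h1 : W.card ≤ (W \ U).card + U.card := by
      have := Finset.card_le_card (Finset.sdiff_union_self_eq_union (s := W) (t := U) ▸
        Finset.subset_union_left : W ⊆ (W \ U) ∪ U)
      exact this.trans (Finset.card_union_le _ _)
    have h2 : (W.card : ℝ) ≤ (W \ U).card + U.card := by exact_mod_cast h1
    linarith
  -- Each chosen vertex costs `(w + σ)n`. Before the last choice at least `wn` candidates remain; at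
  -- the last one `1 - 2w - pw = 0`, and only the gain `w ^ 3`, less the `σ` errors, is left.
  have hgreedy := G.card_cliqueTuples_ge_of_degree (S := W \ U) (m := (w + σ) * n)
    (a := w * n) (b := w ^ 3 / 2 * n) (p := p)
    (fun v hv => by
      have := hdeg v (Finset.mem_sdiff.1 hv).2
      linarith) (by positivity) (by positivity)
    (fun k hk => by
      have hk1 : (k : ℝ) + 3 ≤ r := by
        rw [hrp]
        have : (k : ℝ) + 1 ≤ p := by exact_mod_cast hk
        linarith
      have e1 : w ≤ (1 - 2 * w + w ^ 3 - σ) - k * (w + σ) := by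
        have h1 : (k + 3) * (w + σ) ≤ r * (w + σ) := by gcongr
        have h2 : 0 < w ^ 3 := by positivity
        linarith
      have := mul_le_mul_of_nonneg_right e1 hn0.le
      linarith)
    (by
      have e1 : w ^ 3 / 2 ≤ (1 - 2 * w + w ^ 3 - σ) - p * (w + σ) := by
        have h1 : (p + 2) * (w + σ) = r * (w + σ) := by rw [hrp]
        have h2 : 0 < w ^ 3 := by positivity
        linarith
      have := mul_le_mul_of_nonneg_right e1 hn0.le
      linarith)
  have hsub : ((G.cliqueTuples (W \ U) (p + 1)).card : ℝ) ≤ G.jointSize (p + 1) (x i) (x j) := by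
    exact_mod_cast Finset.card_le_card (cliqueTuples_mono le_rfl Finset.sdiff_subset _)
  refine le_trans ?_ (hgreedy.trans hsub)
  have e1 : n ^ (p + 1) / r ^ (p + 4) = w * w ^ 3 * n * (w * n) ^ p := by
    rw [div_eq_mul_inv, ← inv_pow, ← one_div, ← hw]; ring
  rw [e1]
  have e2 : w * w ^ 3 ≤ w ^ 3 / 2 := by nlinarith [pow_pos hw0 3]
  gcongr

open Classical in
/-- If the non-exceptional vertices have large degree and span no `(r + 1)`-clique, they span an
`r`-colourable graph. -/
lemma exists_partition_of_cliqueTuples_eq_empty (G : SimpleGraph V) {r : ℕ} (hr : 2 ≤ r) {σ : ℝ}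
    {U : Finset V} (hσr : 32 * (r : ℝ) ^ 5 * σ ≤ 1) (hσ : 0 < σ) (hn : 0 < Fintype.card V)
    (hU : (U.card : ℝ) ≤ σ * Fintype.card V)
    (hdeg : ∀ v ∉ U, (1 - 1 / (r : ℝ) - σ) * Fintype.card V ≤
      (Finset.univ.filter fun u => G.Adj v u).card)
    (hK : G.cliqueTuples Uᶜ (r + 1) = ∅) :
    ∃ f : V → Fin r, ∀ u v, u ∉ U → v ∉ U → G.Adj u v → f u ≠ f v := by
  set n : ℝ := (Fintype.card V : ℝ) with hn'
  have hn0 : 0 < n := Nat.cast_pos.2 hn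
  have hr2 : (2 : ℝ) ≤ r := by exact_mod_cast hr
  have hr5 : (r : ℝ) ^ 2 ≤ (r : ℝ) ^ 5 := pow_le_pow_right₀ (by linarith) (by norm_num)
  have hσ2 : 32 * (r : ℝ) ^ 2 * σ ≤ 1 := by nlinarith
  have hr4 : (4 : ℝ) ≤ (r : ℝ) ^ 2 := by nlinarith
  have hσ1 : 128 * σ ≤ 1 := by linarith [mul_le_mul_of_nonneg_right hr4 hσ.le]
  let s : Set V := {v | v ∉ U}
  let H := G.induce s
  have hfree : H.CliqueFree (r + 1) := by
    by_contra hcon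
    rw [not_cliqueFree_iff_top_isContained] at hcon
    obtain ⟨c⟩ := hcon
    have : (fun i => (c i : V)) ∈ G.cliqueTuples Uᶜ (r + 1) := by
      rw [mem_cliqueTuples]
      refine ⟨fun i => Finset.mem_compl.2 (c i).2, fun i j hij => ?_⟩
      exact c.toHom.map_adj (v := i) (w := j) hij
    rw [hK] at this
    simp at this
  have hcards : Fintype.card s ≤ Fintype.card V := Fintype.card_subtype_le _
  have hne : Nonempty s := by
    by_contra hemp
    have : Finset.univ ⊆ U := fun v _ => by
      by_contra hv
      exact hemp ⟨⟨v, hv⟩⟩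
    have h1 : n ≤ U.card := by
      rw [hn', ← Finset.card_univ]
      exact_mod_cast Finset.card_le_card this
    nlinarith
  have hdegH : ∀ v : s, (1 - 1 / (r : ℝ) - 2 * σ) * n ≤ H.degree v := by
    intro v
    have h1 : (Finset.univ.filter fun u => G.Adj v u) ⊆
        (H.neighborFinset v).map (Function.Embedding.subtype _) ∪ U := by
      intro u hu
      by_cases huU : u ∈ U
      · exact Finset.mem_union_right _ huU
      · refine Finset.mem_union_left _ (Finset.mem_map.2 ⟨⟨u, huU⟩, ?_, rfl⟩)
        rw [mem_neighborFinset]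
        exact (Finset.mem_filter.1 hu).2
    have h2 := (Finset.card_le_card h1).trans (Finset.card_union_le _ _)
    rw [Finset.card_map, card_neighborFinset_eq_degree] at h2
    have h3 : ((Finset.univ.filter fun u => G.Adj v u).card : ℝ) ≤ H.degree v + U.card := by
      exact_mod_cast h2
    have := hdeg v v.2
    linarith
  -- Andrásfai–Erdős–Sós needs minimum degree above `(3r-4)/(3r-1)` of the order. Since `1 - 1/r`
  -- exceeds this by `1/(r(3r-1))`, there is room for the loss `2σ`.
  have hcol : H.Colorable r := by
    refine colorable_of_cliqueFree_lt_minDegree hfree ?_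
    refine lt_of_lt_of_le ?_ (H.le_minDegree_of_forall_le_degree
      ((3 * r - 4) * Fintype.card s / (3 * r - 1) + 1) fun v => ?_)
    · omega
    · have h1 : ((3 * r - 4) * Fintype.card s / (3 * r - 1) : ℕ) < H.degree v := by
        rw [Nat.div_lt_iff_lt_mul (by omega)]
        have h2 : ((3 * r - 4 : ℕ) : ℝ) = 3 * r - 4 := by
          rw [Nat.cast_sub (by omega)]; push_cast; ring
        have h3 : ((3 * r - 1 : ℕ) : ℝ) = 3 * r - 1 := by
          rw [Nat.cast_sub (by omega)]; push_cast; ring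
        have h4 : ((3 * r - 4 : ℕ) : ℝ) * Fintype.card s < H.degree v * ((3 * r - 1 : ℕ) : ℝ) := by
          rw [h2, h3]
          have h5 : (Fintype.card s : ℝ) ≤ n := Nat.cast_le.2 hcards
          have h6 : (3 * (r : ℝ) - 4) < (1 - 1 / (r : ℝ) - 2 * σ) * (3 * r - 1) := by
            have e : (r : ℝ) * (1 / r) = 1 := by field_simp
            have e1 : 0 < 1 / (r : ℝ) := by positivity
            have e2 : r * σ * 32 ≤ 1 / r := by
              rw [le_div_iff₀ (by linarith)]; linarith
            nlinarith
          calc (3 * (r : ℝ) - 4) * Fintype.card s ≤ (3 * (r : ℝ) - 4) * n := by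
                gcongr; linarith
            _ < (1 - 1 / (r : ℝ) - 2 * σ) * (3 * r - 1) * n := by gcongr
            _ = (1 - 1 / (r : ℝ) - 2 * σ) * n * (3 * r - 1) := by ring
            _ ≤ _ := by
              have := hdegH v
              gcongr
              linarith
        exact_mod_cast h4
      omega
  obtain ⟨C⟩ := hcol
  refine ⟨fun v => if h : v ∈ s then C ⟨v, h⟩ else ⟨0, by omega⟩, fun u v hu hv huv => ?_⟩
  have hu' : u ∈ s := hu
  have hv' : v ∈ s := hv
  simp only [dif_pos hu', dif_pos hv']
  exact C.valid huv

end SimpleGraph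

/-! ### From a nearly balanced partition to the Turán graph -/

lemma exists_injOn_lt_card {V : Type*} (S : Finset V) :
    ∃ ρ : V → ℕ, Set.InjOn ρ S ∧ ∀ v ∈ S, ρ v < S.card := by
  classical
  refine ⟨fun v => if h : v ∈ S then S.equivFin ⟨v, h⟩ else 0, fun u hu v hv huv => ?_,
    fun v hv => ?_⟩
  · rw [Finset.mem_coe] at hu hv
    simp only [dif_pos hu, dif_pos hv] at huv
    exact congrArg Subtype.val (S.equivFin.injective (Fin.ext huv))
  · simp only [dif_pos hv]
    exact (S.equivFin ⟨v, hv⟩).2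

open Classical in
/-- A partition of `V` outside `U` into `r` classes of size at most `n / r + t` can be matched with
the residue classes modulo `r`, up to few vertices. -/
lemma exists_equiv_fin_mod_eq {V : Type*} [Fintype V] {n r : ℕ} (hV : Fintype.card V = n)
    (hr : 0 < r) (f : V → Fin r) (U : Finset V) {t : ℝ} (ht : 0 ≤ t)
    (hcard : ∀ i, ((Finset.univ.filter fun v => v ∉ U ∧ f v = i).card : ℝ) ≤ n / r + t) :
    ∃ (φ : V ≃ Fin n) (B : Finset V), (B.card : ℝ) ≤ U.card + r * (t + 1) ∧
      ∀ v ∉ B, v ∉ U ∧ (φ v : ℕ) % r = f v := by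
  set C : Fin r → Finset V := fun i => Finset.univ.filter fun v => v ∉ U ∧ f v = i with hC
  have hmemC : ∀ v, v ∉ U → v ∈ C (f v) := fun v hv => by simp [hC, hv]
  choose ρ hinj hlt using fun i => exists_injOn_lt_card (C i)
  set q := n / r with hq
  -- In `turanGraph n r` the classes are the residues modulo `r`. The vertex of rank `ρ` in class
  -- `i` is sent to `ρ r + i`, which is below `n` whenever `ρ < n / r`.
  let g : V → ℕ := fun v => ρ (f v) v * r + f v
  have hgmod : ∀ v, g v % r = f v := fun v => by
    simp only [g]
    rw [Nat.mul_add_mod', Nat.mod_eq_of_lt (f v).2]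
  let S : Finset V := Finset.univ.filter fun v => v ∉ U ∧ ρ (f v) v < q
  have hglt : ∀ v ∈ S, g v < n := fun v hv => by
    have h1 : ρ (f v) v + 1 ≤ q := (Finset.mem_filter.1 hv).2.2
    have h2 : (ρ (f v) v + 1) * r ≤ q * r := Nat.mul_le_mul_right _ h1
    have h3 : q * r ≤ n := Nat.div_mul_le_self n r
    have h4 := (f v).2
    simp only [g]
    rw [add_mul] at h2
    omega
  have hnpos : ∀ v : V, 0 < n := fun v => hV ▸ Fintype.card_pos_iff.2 ⟨v⟩
  let g' : V → Fin n := fun v => if h : g v < n then ⟨g v, h⟩ else ⟨0, hnpos v⟩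
  have hg' : ∀ v ∈ S, (g' v : ℕ) = g v := fun v hv => by simp [g', hglt v hv]
  have hinjS : Set.InjOn g' S := by
    intro u hu v hv huv
    have h1 : g u = g v := by rw [← hg' u hu, ← hg' v hv, huv]
    have h2 : f u = f v := Fin.ext (by rw [← hgmod u, ← hgmod v, h1])
    have h3 : ρ (f u) u = ρ (f u) v := by
      simp only [g, ← h2] at h1
      exact Nat.eq_of_mul_eq_mul_right hr (Nat.add_right_cancel h1)
    exact hinj (f u) (hmemC u (Finset.mem_filter.1 hu).2.1)
      (h2 ▸ hmemC v (Finset.mem_filter.1 hv).2.1) h3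
  -- The remaining vertices are placed arbitrarily: those of `U` and at most `t + 1` overflowing
  -- ones per class.
  obtain ⟨φ', hφ'⟩ := Finset.exists_equiv_extend_of_card_eq (t := (Finset.univ : Finset (Fin n)))
    (by simp [hV]) (Finset.subset_univ (S.image g')) hinjS
  let φ : V ≃ Fin n := φ'.trans (Equiv.subtypeUnivEquiv fun x => Finset.mem_univ x)
  refine ⟨φ, Sᶜ, ?_, fun v hv => ?_⟩
  · have hsub : Sᶜ ⊆ U ∪ Finset.univ.biUnion fun i => (C i).filter fun v => q ≤ ρ i v := by
      intro v hv
      by_cases hU : v ∈ U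
      · exact Finset.mem_union_left _ hU
      · refine Finset.mem_union_right _ (Finset.mem_biUnion.2 ⟨f v, Finset.mem_univ _,
          Finset.mem_filter.2 ⟨hmemC v hU, ?_⟩⟩)
        by_contra! h
        exact Finset.mem_compl.1 hv (Finset.mem_filter.2 ⟨Finset.mem_univ _, hU, h⟩)
    have hi : ∀ i, (((C i).filter fun v => q ≤ ρ i v).card : ℝ) ≤ t + 1 := by
      intro i
      have h1 : ((C i).filter fun v => q ≤ ρ i v).card ≤ (Finset.Ico q (C i).card).card := by
        refine Finset.card_le_card_of_injOn (ρ i) (fun v hv => ?_)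
          ((hinj i).mono (Finset.coe_subset.2 (Finset.filter_subset _ _)))
        obtain ⟨h1, h2⟩ := Finset.mem_filter.1 (Finset.mem_coe.1 hv)
        exact Finset.mem_coe.2 (Finset.mem_Ico.2 ⟨h2, hlt i v h1⟩)
      rw [Nat.card_Ico] at h1
      rcases le_total (C i).card q with h | h
      · rw [Nat.sub_eq_zero_of_le h] at h1
        rw [Nat.le_zero.1 h1]
        push_cast
        linarith
      · have h2 : (((C i).filter fun v => q ≤ ρ i v).card : ℝ) ≤ (C i).card - q := by
          rw [← Nat.cast_sub h]
          exact_mod_cast h1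
        have h3 : (n : ℝ) / r ≤ q + 1 := (Nat.lt_floor_add_one _).le.trans
          (by rw [Nat.floor_div_natCast, Nat.floor_natCast])
        have h4 : ((C i).card : ℝ) ≤ n / r + t := hcard i
        linarith
    have h1 := (Finset.card_le_card hsub).trans ((Finset.card_union_le _ _).trans
      (Nat.add_le_add_left Finset.card_biUnion_le _))
    have h2 : ((Sᶜ).card : ℝ) ≤ U.card +
        ∑ i, (((C i).filter fun v => q ≤ ρ i v).card : ℝ) := by exact_mod_cast h1
    have h3 : ∑ i, (((C i).filter fun v => q ≤ ρ i v).card : ℝ) ≤ r * (t + 1) :=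
      (Finset.sum_le_sum fun i _ => hi i).trans_eq (by simp; ring)
    linarith
  · have hvS : v ∈ S := by simpa using hv
    refine ⟨(Finset.mem_filter.1 hvS).2.1, ?_⟩
    have : φ v = g' v := hφ' v hvS
    rw [this, hg' v hvS, hgmod]

namespace SimpleGraph

open Classical in
/-- A graph with an `r`-colourable subgraph of large minimum degree outside a small exceptional set
is close to the Turán graph. -/
lemma differsInFewerThan_turanGraph {V : Type*} [Fintype V] {n r : ℕ} (hV : Fintype.card V = n)
    (hr : 2 ≤ r) {G G' : SimpleGraph V} (hle : G' ≤ G) {σ x : ℝ} (hσ : 0 < σ) {U : Finset V}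
    (hU : (U.card : ℝ) ≤ σ * n)
    (hdeg : ∀ v ∉ U, (1 - 1 / (r : ℝ) - σ) * n ≤ (Finset.univ.filter fun u => G'.Adj v u).card)
    (f : V → Fin r) (hf : ∀ u v, u ∉ U → v ∉ U → G'.Adj u v → f u ≠ f v)
    (hx : (G \ G').adjPairs.card + (2 * ((r + 1) * (σ * n) + r) + (r + 1) * (σ * n)) * n < 2 * x) :
    DiffersInFewerThan G (turanGraph n r) x := by
  have hr0 : (0 : ℝ) < r := by positivity
  set C : Fin r → Finset V := fun i => Finset.univ.filter fun v => v ∉ U ∧ f v = i with hC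
  have hn0 : (0 : ℝ) ≤ n := by positivity
  -- The class of `u`, the missing cross pairs at `u` and the neighbours of `u` are disjoint, and
  -- the neighbours leave room for only `n/r + σn` vertices.
  have hsplit : ∀ u ∉ U, ((C (f u)).card : ℝ) +
      (Finset.univ.filter fun v => v ∉ U ∧ f v ≠ f u ∧ ¬ G'.Adj u v).card ≤ n / r + σ * n := by
    intro u hu
    have hd1 : Disjoint (C (f u)) (Finset.univ.filter fun v => v ∉ U ∧ f v ≠ f u ∧ ¬ G'.Adj u v) := by
      rw [Finset.disjoint_left]
      intro v hv hv'
      exact (Finset.mem_filter.1 hv').2.2.1 (Finset.mem_filter.1 hv).2.2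
    have hd2 : Disjoint (C (f u) ∪ Finset.univ.filter fun v => v ∉ U ∧ f v ≠ f u ∧ ¬ G'.Adj u v)
        (Finset.univ.filter fun v => G'.Adj u v) := by
      rw [Finset.disjoint_left]
      intro v hv hv'
      have huv := (Finset.mem_filter.1 hv').2
      rcases Finset.mem_union.1 hv with h | h
      · exact hf u v hu (Finset.mem_filter.1 h).2.1 huv (Finset.mem_filter.1 h).2.2.symm
      · exact (Finset.mem_filter.1 h).2.2.2 huv
    have h1 := Finset.card_le_univ ((C (f u) ∪ Finset.univ.filter
      fun v => v ∉ U ∧ f v ≠ f u ∧ ¬ G'.Adj u v) ∪ Finset.univ.filter fun v => G'.Adj u v)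
    rw [Finset.card_union_of_disjoint hd2, Finset.card_union_of_disjoint hd1, hV] at h1
    have h2 : ((C (f u)).card : ℝ) +
      (Finset.univ.filter fun v => v ∉ U ∧ f v ≠ f u ∧ ¬ G'.Adj u v).card +
      (Finset.univ.filter fun v => G'.Adj u v).card ≤ n := by exact_mod_cast h1
    have h3 := hdeg u hu
    have h4 : (1 - 1 / (r : ℝ) - σ) * n = n - n / r - σ * n := by ring
    linarith
  have hCle : ∀ i, ((C i).card : ℝ) ≤ n / r + σ * n := by
    intro i
    rcases (C i).eq_empty_or_nonempty with h | ⟨u, hu⟩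
    · rw [h]
      simp only [Finset.card_empty, Nat.cast_zero]
      positivity
    · obtain ⟨hu1, rfl⟩ := (Finset.mem_filter.1 hu).2
      have := hsplit u hu1
      have h0 : (0 : ℝ) ≤
        (Finset.univ.filter fun v => v ∉ U ∧ f v ≠ f u ∧ ¬ G'.Adj u v).card := by positivity
      linarith
  -- All other classes are at most `n/r + σn` and `U` is at most `σn`, so no class can be much
  -- smaller than `n/r`.
  have hCge : ∀ i, (n : ℝ) / r - r * (σ * n) ≤ (C i).card := by
    intro i
    have h1 : (Finset.univ : Finset V) ⊆ U ∪ Finset.univ.biUnion C := fun v _ => by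
      by_cases hv : v ∈ U
      · exact Finset.mem_union_left _ hv
      · exact Finset.mem_union_right _ (Finset.mem_biUnion.2 ⟨f v, Finset.mem_univ _, by
          simp [hC, hv]⟩)
    have h2 := (Finset.card_le_card h1).trans ((Finset.card_union_le _ _).trans
      (Nat.add_le_add_left Finset.card_biUnion_le _))
    rw [Finset.card_univ, hV] at h2
    have h3 : (n : ℝ) ≤ U.card + ∑ i, ((C i).card : ℝ) := by exact_mod_cast h2
    rw [← Finset.add_sum_erase _ _ (Finset.mem_univ i)] at h3
    have h4 : ∑ j ∈ Finset.univ.erase i, ((C j).card : ℝ) ≤ (r - 1) * (n / r + σ * n) := by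
      refine (Finset.sum_le_sum fun j _ => hCle j).trans_eq ?_
      rw [Finset.sum_const, Finset.card_erase_of_mem (Finset.mem_univ i), Finset.card_univ,
        Fintype.card_fin, nsmul_eq_mul, Nat.cast_sub (by omega)]
      simp
    have h5 : (r : ℝ) * (n / r) = n := by field_simp
    linarith
  have hmiss : ∀ u ∉ U, ((Finset.univ.filter fun v => v ∉ U ∧ f v ≠ f u ∧ ¬ G'.Adj u v).card : ℝ) ≤
      (r + 1) * (σ * n) := by
    intro u hu
    have h1 := hsplit u hu
    have h2 := hCge (f u)
    linarith
  obtain ⟨φ, B, hB, hφ⟩ := exists_equiv_fin_mod_eq hV (by omega) f U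
    (t := σ * n) (by positivity) hCle
  refine ⟨φ, ?_⟩
  set H := (turanGraph n r).comap φ with hH
  have hHadj : ∀ u v, u ∉ B → v ∉ B → (H.Adj u v ↔ f u ≠ f v) := by
    intro u v hu hv
    rw [hH, comap_adj, turanGraph_adj, (hφ u hu).2, (hφ v hv).2, Ne, Fin.val_inj]
  have hset : G.edgeSet ∆ H.edgeSet = ((G \ H) ⊔ (H \ G)).edgeSet := by
    rw [edgeSet_sup, edgeSet_sdiff, edgeSet_sdiff]
    rfl
  set X := (G \ H) ⊔ (H \ G) with hX
  -- A pair on which the graphs differ meets a misplaced vertex, is a deleted edge, or is a missing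
  -- cross pair.
  have hsub : X.adjPairs ⊆ (B ×ˢ Finset.univ ∪ Finset.univ ×ˢ B) ∪ ((G \ G').adjPairs ∪
      ((Finset.univ.filter fun u => u ∉ U).sigma fun u => Finset.univ.filter
        fun v => v ∉ U ∧ f v ≠ f u ∧ ¬ G'.Adj u v).map
        (Equiv.sigmaEquivProd V V).toEmbedding) := by
    rintro ⟨u, v⟩ huv
    rw [mem_adjPairs] at huv
    by_cases hu : u ∈ B
    · simp [hu]
    by_cases hv : v ∈ B
    · simp [hv]
    refine Finset.mem_union_right _ ?_
    rcases huv with h | h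
    · refine Finset.mem_union_left _ (mem_adjPairs.2 ⟨h.1, fun h' => h.2 ?_⟩)
      exact (hHadj u v hu hv).2 (hf u v (hφ u hu).1 (hφ v hv).1 h')
    · refine Finset.mem_union_right _ (Finset.mem_map.2 ⟨⟨u, v⟩, ?_, rfl⟩)
      have hne := (hHadj u v hu hv).1 h.1
      simp only [Finset.mem_sigma, Finset.mem_filter, Finset.mem_univ, true_and]
      exact ⟨(hφ u hu).1, (hφ v hv).1, hne.symm, fun h' => h.2 (hle h')⟩
  have hc1 := (Finset.card_le_card hsub).trans ((Finset.card_union_le _ _).trans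
    (add_le_add (Finset.card_union_le _ _) (Finset.card_union_le _ _)))
  rw [Finset.card_product, Finset.card_product, Finset.card_map, Finset.card_sigma,
    Finset.card_univ, hV] at hc1
  have hc2 : (X.adjPairs.card : ℝ) ≤ (B.card * n + n * B.card) + ((G \ G').adjPairs.card +
      ∑ u ∈ Finset.univ.filter fun u => u ∉ U, ((Finset.univ.filter
        fun v => v ∉ U ∧ f v ≠ f u ∧ ¬ G'.Adj u v).card : ℝ)) := by exact_mod_cast hc1
  have hc3 : ∑ u ∈ Finset.univ.filter fun u => u ∉ U, ((Finset.univ.filter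
        fun v => v ∉ U ∧ f v ≠ f u ∧ ¬ G'.Adj u v).card : ℝ) ≤ n * ((r + 1) * (σ * n)) := by
    refine (Finset.sum_le_sum fun u hu => hmiss u (Finset.mem_filter.1 hu).2).trans ?_
    rw [Finset.sum_const, nsmul_eq_mul]
    have : ((Finset.univ.filter fun u => u ∉ U).card : ℝ) ≤ n := by
      rw [← hV]
      exact_mod_cast Finset.card_le_univ _
    gcongr
  have hc4 : (B.card : ℝ) * n ≤ ((r + 1) * (σ * n) + r) * n := by
    refine mul_le_mul_of_nonneg_right ?_ hn0
    linarith
  have hc5 : (X.adjPairs.card : ℝ) = 2 * X.edgeSet.ncard := by exact_mod_cast card_adjPairs X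
  rw [hset]
  linarith

end SimpleGraph

/-! ### The case of few cliques -/

namespace SimpleGraph

/-- A graph of nearly Turán density with few ordered `(r + 1)`-cliques is close to the Turán
graph. -/
lemma differsInFewerThan_turanGraph_of_few_cliques {V : Type*} [Fintype V] {n p : ℕ}
    (hV : Fintype.card V = n) {G : SimpleGraph V} {b e σ : ℝ} (hb : 0 < b) (he : 0 < e)
    (hbr : b * ((p + 2 : ℕ) : ℝ) ^ (p + 16) ≤ 1) (her : e * ((p + 2 : ℕ) : ℝ) ^ 8 ≤ 1)
    (hσ : σ * ((p + 2 : ℕ) : ℝ) ^ 3 = e + b) (hn : ((p + 2 : ℕ) : ℝ) ≤ σ * n)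
    (hG : (1 - 1 / ((p + 2 : ℕ) : ℝ) - e ^ 3) * (n : ℝ) ^ 2 ≤ G.adjPairs.card)
    (hK : ((G.cliqueTuples Finset.univ (p + 3)).card : ℝ) < b ^ 3 * (n : ℝ) ^ (p + 3)) :
    DiffersInFewerThan G (turanGraph n (p + 2)) ((e + b) * (n : ℝ) ^ 2) := by
  classical
  set r : ℝ := ((p + 2 : ℕ) : ℝ) with hr
  have hr2 : 2 ≤ r := by rw [hr]; push_cast; linarith [(Nat.cast_nonneg p : (0 : ℝ) ≤ p)]
  have hr0 : 0 < r := by linarith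
  have hσ0 : 0 < σ := by
    by_contra! h
    have := mul_nonpos_of_nonpos_of_nonneg h (by positivity : 0 ≤ r ^ 3)
    linarith
  have hn0 : (0 : ℝ) < n := by
    by_contra! h
    have := mul_nonpos_of_nonneg_of_nonpos hσ0.le h
    linarith
  have hpow : ∀ k : ℕ, (2 : ℝ) ^ k ≤ r ^ k := fun k => by gcongr
  have hr6 := hpow 6
  have hr2' := hpow 2
  have hbr16 : b * r ^ 16 ≤ 1 := by
    refine le_trans ?_ hbr
    gcongr
    · linarith
    · omega
  have hb8 : b * r ^ 8 ≤ 1 / 256 := by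
    have h1 : b * r ^ 8 * 2 ^ 8 ≤ b * r ^ 8 * r ^ 8 := by gcongr
    have h2 : b * r ^ 8 * r ^ 8 = b * r ^ 16 := by ring
    linarith
  have hτ : (e + b) * r ^ 2 * 32 ≤ 1 := by
    have h1 : (e + b) * r ^ 2 * 2 ^ 6 ≤ (e + b) * r ^ 2 * r ^ 6 := by gcongr
    have h2 : (e + b) * r ^ 2 * r ^ 6 = e * r ^ 8 + b * r ^ 8 := by ring
    linarith
  have hσ5 : 32 * r ^ 5 * σ ≤ 1 := by
    have : 32 * r ^ 5 * σ = (e + b) * r ^ 2 * 32 := by rw [← hσ]; ring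
    linarith
  have hσsq : e ^ 2 + b ^ 2 ≤ σ ^ 2 * r ^ 6 := by
    have : σ ^ 2 * r ^ 6 = (e + b) ^ 2 := by rw [← hσ]; ring
    rw [this]
    nlinarith
  -- `η n²` bounds the deleted ordered pairs: fewer than `b³ n^(p+3)` cliques, divided by the
  -- threshold `d` below. Both `η` and `e ^ 3` are small against `σ²`, because `σ² r⁶ ≥ e² + b²`.
  set η : ℝ := b ^ 3 * r ^ (p + 4) with hη
  have hη6 : η * r ^ 6 * 64 ≤ b ^ 2 := by
    calc η * r ^ 6 * 64 ≤ η * r ^ 6 * r ^ 6 := by gcongr; linarith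
      _ = b ^ 2 * (b * r ^ (p + 16)) := by rw [hη]; ring
      _ ≤ b ^ 2 * 1 := by gcongr
      _ = b ^ 2 := mul_one _
  have he6 : e ^ 3 * r ^ 6 * 4 ≤ e ^ 2 := by
    calc e ^ 3 * r ^ 6 * 4 ≤ e ^ 3 * r ^ 6 * r ^ 2 := by gcongr; linarith
      _ = e ^ 2 * (e * r ^ 8) := by ring
      _ ≤ e ^ 2 * 1 := by gcongr
      _ = e ^ 2 := mul_one _
  have hr6pos : 0 < r ^ 6 := by positivity
  have hα : 2 * (e ^ 3 + η) ≤ σ ^ 2 := by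
    refine le_of_mul_le_mul_right ?_ hr6pos
    linarith [sq_nonneg e, sq_nonneg b]
  have hησ : 64 * η ≤ σ ^ 2 := by
    refine le_of_mul_le_mul_right ?_ hr6pos
    linarith [sq_nonneg e]
  have hβ : 4 * b ^ 3 * r ^ (p + 2) ≤ σ ^ 2 := by
    have h1 : b ^ 3 * r ^ (p + 2) ≤ η := by
      rw [hη]
      gcongr
      · linarith
      · omega
    have h2 : 0 < η := by positivity
    linarith
  -- The clique count that `cliqueTuples_compl_eq_empty` forces on some edge of a clique outside
  -- `U`.
  set d : ℝ := (n : ℝ) ^ (p + 1) / r ^ (p + 4) with hd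
  have hd0 : 0 < d := by positivity
  set G' := G.lightSubgraph (p + 1) d with hG'
  have hle : G' ≤ G := G.lightSubgraph_le _ _
  have hheavy : ((G \ G').adjPairs.card : ℝ) ≤ η * (n : ℝ) ^ 2 := by
    have h1 := (G.mul_card_adjPairs_sdiff_lightSubgraph_le (p + 1) (d := d)).trans hK.le
    have h2 : b ^ 3 * (n : ℝ) ^ (p + 3) = d * (η * (n : ℝ) ^ 2) := by
      rw [hd, hη]; field_simp; ring
    rw [h2] at h1
    exact le_of_mul_le_mul_left h1 hd0
  have hpairs : (1 - 1 / r - (e ^ 3 + η)) * (Fintype.card V : ℝ) ^ 2 ≤ G'.adjPairs.card := by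
    have h1 : G.adjPairs ⊆ G'.adjPairs ∪ (G \ G').adjPairs := fun x hx => by
      rw [mem_adjPairs] at hx
      rw [Finset.mem_union, mem_adjPairs, mem_adjPairs, sdiff_adj]
      tauto
    have h2 : (G.adjPairs.card : ℝ) ≤ G'.adjPairs.card + (G \ G').adjPairs.card := by
      exact_mod_cast (Finset.card_le_card h1).trans (Finset.card_union_le _ _)
    rw [hV]
    linarith
  have hK' : ((G'.cliqueTuples Finset.univ (p + 2 + 1)).card : ℝ) <
      b ^ 3 * (Fintype.card V : ℝ) ^ (p + 2 + 1) := by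
    rw [hV]
    refine lt_of_le_of_lt ?_ hK
    exact_mod_cast Finset.card_le_card (cliqueTuples_mono hle le_rfl _)
  set U : Finset V := Finset.univ.filter fun u =>
    ((Finset.univ.filter fun v => G'.Adj u v).card : ℝ) ≤ (1 - 1 / r - σ) * n with hUdef
  have hU : (U.card : ℝ) < σ * Fintype.card V :=
    G'.card_lt_of_forall_degree_lt (r := p + 2) (by omega) hσ0 hσ5 (by rwa [hV]) hα hβ hpairs hK'
      fun u hu => by rw [hV]; exact (Finset.mem_filter.1 hu).2
  have hdeg : ∀ v ∉ U, (1 - 1 / r - σ) * Fintype.card V ≤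
      (Finset.univ.filter fun u => G'.Adj v u).card := fun v hv => by
    by_contra! h
    rw [hV] at h
    exact hv (Finset.mem_filter.2 ⟨Finset.mem_univ _, h.le⟩)
  have hVpos : 0 < Fintype.card V := by rw [hV]; exact_mod_cast hn0
  have hempty := G'.cliqueTuples_compl_eq_empty hσ5 hσ0 hVpos hU.le
    (fun v hv => (hdeg v hv).trans_eq (by
      congr 2
      ext u
      simp [mem_commonNeighborsIn, G'.adj_comm]))
    (fun u v huv => by
      rw [hV]
      refine lt_of_le_of_lt ?_ huv.2
      exact_mod_cast jointSize_mono hle _ u v)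
  obtain ⟨f, hf⟩ := G'.exists_partition_of_cliqueTuples_eq_empty (r := p + 2) (by omega) hσ5 hσ0
    hVpos hU.le hdeg hempty
  rw [hV] at hU hdeg
  refine differsInFewerThan_turanGraph hV (by omega) hle hσ0 hU.le hdeg f hf ?_
  rw [← hr]
  have hσ1 : σ ^ 2 ≤ σ := by
    have h1 : σ * 1 ≤ σ * r ^ 5 := by
      gcongr
      exact one_le_pow₀ (by linarith)
    have h2 : σ ≤ 1 := by linarith
    nlinarith only [hσ0, h2]
  -- The choice of `σ` makes the right side `2 r³ σ`. The summand `2σ` covers the rounding term `2r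
  -- ≤ 2σn`.
  have hcoef : η + (3 * (r + 1) + 2) * σ < 2 * (e + b) := by
    have h1 : 4 * r ≤ r ^ 3 := by
      have := mul_le_mul_of_nonneg_left hr2' hr0.le
      linarith
    have h2 : σ * (4 * r) ≤ σ * r ^ 3 := by gcongr
    have h3 : σ * 2 ≤ σ * r := by gcongr
    linarith
  calc ((G \ G').adjPairs.card : ℝ) + (2 * ((r + 1) * (σ * n) + r) + (r + 1) * (σ * n)) * n
      ≤ η * (n : ℝ) ^ 2 + (2 * ((r + 1) * (σ * n) + σ * n) + (r + 1) * (σ * n)) * n := by gcongr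
    _ = (η + (3 * (r + 1) + 2) * σ) * (n : ℝ) ^ 2 := by ring
    _ < 2 * (e + b) * (n : ℝ) ^ 2 := by gcongr
    _ = 2 * ((e + b) * (n : ℝ) ^ 2) := by ring

end SimpleGraph

/-! ### The case of many cliques: choice of parameters -/

lemma Real.le_exp_half_self (x : ℝ) (hx : 0 ≤ x) : x ≤ Real.exp (x / 2) := by
  have h1 : x / 4 + 1 ≤ Real.exp (x / 4) := Real.add_one_le_exp _
  have h2 : Real.exp (x / 2) = Real.exp (x / 4) ^ 2 := by
    rw [← Real.exp_nat_mul]; congr 1; push_cast; ring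
  have h3 : (x / 4 + 1) ^ 2 ≤ Real.exp (x / 4) ^ 2 := by gcongr
  nlinarith [sq_nonneg (x / 4 - 1)]

/-- With `y = 1/q`, cubing `y/6 ≤ exp (y/6)` gives `y³/216 ≤ exp (y/2)`, and `y ≥ 216`. It is used
with `q = √c` and `x = log n`, to show `1/c ≤ n^(√c/2)`. -/
lemma Real.inv_sq_le_exp {q x : ℝ} (hq0 : 0 < q) (hq1 : 216 * q ≤ 1) (hx : 1 / q ^ 2 ≤ x) :
    1 / q ^ 2 ≤ Real.exp (q * x / 2) := by
  set y := 1 / q with hy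
  have hy0 : 0 < y := by positivity
  have hy216 : 216 ≤ y := by rw [hy, le_div_iff₀ hq0]; exact hq1
  have hyx : y ≤ q * x := by
    have h1 : q * (1 / q ^ 2) ≤ q * x := by gcongr
    have h2 : q * (1 / q ^ 2) = y := by rw [hy]; field_simp
    linarith
  have h1 : y / 6 ≤ Real.exp (y / 6) := by linarith [Real.add_one_le_exp (y / 6)]
  have h2 : Real.exp (y / 2) = Real.exp (y / 6) ^ 3 := by
    rw [← Real.exp_nat_mul]; congr 1; push_cast; ring
  calc 1 / q ^ 2 = y ^ 2 := by rw [hy, one_div_pow]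
    _ ≤ y ^ 2 * (y / 216) := le_mul_of_one_le_right (by positivity) (by linarith)
    _ = (y / 6) ^ 3 := by ring
    _ ≤ Real.exp (y / 6) ^ 3 := by gcongr
    _ = Real.exp (y / 2) := h2.symm
    _ ≤ _ := Real.exp_le_exp.2 (by linarith)

/-- Many ordered `(r + 1)`-cliques force a complete `(r + 1)`-partite subgraph of logarithmic
size. -/
lemma completePartiteGraph_isContained_of_many_cliques {V : Type*} [Fintype V] {r n : ℕ}
    (hV : Fintype.card V = n) (hr : 2 ≤ r) {G : SimpleGraph V} {β c : ℝ} (hβ : 0 < β)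
    (hβr : β * (r : ℝ) ^ (3 * r + 42) ≤ 1) (hc : β ^ (r + 1) = c) (hn : Real.exp (1 / c) < n)
    (hK : β * (n : ℝ) ^ (r + 1) ≤ (G.cliqueTuples Finset.univ (r + 1)).card) :
    completePartiteGraph (lastClassSizes (r + 1) ⌊c * Real.log n⌋₊ ⌈(n : ℝ) ^ (1 - √c)⌉₊) ⊑ G := by
  have hr2 : (2 : ℝ) ≤ r := by exact_mod_cast hr
  have hr0 : (0 : ℝ) < r := by linarith
  have hc0 : 0 < c := hc ▸ by positivity
  have hn0 : (0 : ℝ) < n := (Real.exp_pos _).trans hn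
  set L := Real.log n with hL
  have hnL : Real.exp L = n := Real.exp_log hn0
  have hcL : 1 / c < L := (Real.lt_log_iff_exp_lt hn0).2 hn
  have hL0 : 0 < L := lt_trans (by positivity) hcL
  have hr40 : (r : ℝ) ^ 40 ≤ (r : ℝ) ^ (3 * r + 42) :=
    pow_le_pow_right₀ (by linarith) (by omega)
  have hβ40 : β * (r : ℝ) ^ 40 ≤ 1 := (mul_le_mul_of_nonneg_left hr40 hβ.le).trans hβr
  have hβr2 : 2 ^ 38 * (β * (r : ℝ) ^ 2) ≤ 1 := by
    have h1 : (2 : ℝ) ^ 38 ≤ (r : ℝ) ^ 38 := by gcongr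
    calc 2 ^ 38 * (β * (r : ℝ) ^ 2) ≤ (r : ℝ) ^ 38 * (β * (r : ℝ) ^ 2) := by gcongr
      _ = β * (r : ℝ) ^ 40 := by ring
      _ ≤ 1 := hβ40
  have hβr1 : 2 ^ 39 * (β * (r : ℝ)) ≤ 1 := by nlinarith [mul_pos hβ hr0]
  have hβ1 : 2 ^ 40 * β ≤ 1 := by nlinarith
  have hβle : β ≤ 1 := by linarith
  set D : ℕ := ⌊2 * (r + 1) / β⌋₊ + 1 with hD
  have hD0 : 0 < D := Nat.succ_pos _
  have hDgt : 2 * (r + 1) / β < (D : ℝ) := by rw [hD]; push_cast; exact Nat.lt_floor_add_one _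
  have hDβ : 2 * ((r : ℝ) + 1) < D * β := (div_lt_iff₀ hβ).1 hDgt
  have hDle : D * β ≤ 4 * r := by
    have h1 : (D : ℝ) ≤ 2 * (r + 1) / β + 1 := by
      rw [hD]; push_cast
      gcongr
      exact Nat.floor_le (by positivity)
    have h2 : (D : ℝ) * β ≤ (2 * (r + 1) / β + 1) * β := by gcongr
    have h3 : (2 * ((r : ℝ) + 1) / β + 1) * β = 2 * (r + 1) + β := by field_simp
    linarith
  have hc2 : c ≤ β ^ 3 := by
    rw [← hc]; exact pow_le_pow_of_le_one hβ.le hβle (by omega)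
  have hDc : (D : ℝ) * c ≤ 1 := by
    calc (D : ℝ) * c ≤ D * β ^ 3 := by gcongr
      _ = (D * β) * β * β := by ring
      _ ≤ (4 * r) * β * β := by gcongr
      _ = 4 * (β * r) * β := by ring
      _ ≤ 1 * 1 := by gcongr; linarith
      _ = 1 := one_mul 1
  have hD1c : (D : ℝ) ≤ 1 / c := (le_div_iff₀ hc0).2 hDc
  set s := ⌊c * L⌋₊ with hs
  have hs0 : 0 < s := by
    rw [hs, Nat.floor_pos]
    exact ((div_lt_iff₀' hc0).1 hcL).le
  have hsle : (s : ℝ) ≤ c * L := Nat.floor_le (by positivity)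
  have h2exp : ∀ k : ℕ, (2 : ℝ) ^ k ≤ Real.exp k := by
    intro k
    rw [← Real.exp_one_pow]
    gcongr
    linarith [Real.add_one_le_exp 1]
  refine SimpleGraph.isContained_of_card_cliqueTuples hD0 (by omega) hs0 ?_ ?_ ?_
  · rw [hV]
    have h1 : 2 * ((r : ℝ) + 1) * (n : ℝ) ^ (r + 1) <
        D * (G.cliqueTuples Finset.univ (r + 1)).card := by
      calc _ < D * β * (n : ℝ) ^ (r + 1) := by gcongr
        _ = D * (β * (n : ℝ) ^ (r + 1)) := by ring
        _ ≤ _ := by gcongr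
    exact_mod_cast h1
  · rw [hV]
    -- Since `c = β^r * β`, the factor `D^r` is absorbed by `β^r` up to `(4r)^r`, and the spare `β`
    -- beats that.
    have hX : ((D ^ r * s : ℕ) : ℝ) ≤ L / 8 := by
      push_cast
      have h1 : (4 * (r : ℝ)) ^ r ≤ (r : ℝ) ^ (3 * r) := by
        rw [pow_mul]
        gcongr
        nlinarith
      have h2 : (4 * (r : ℝ)) ^ r * β ≤ 1 / 8 := by
        have h3 : (8 : ℝ) ≤ (r : ℝ) ^ 42 := by
          calc (8 : ℝ) ≤ 2 ^ 42 := by norm_num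
            _ ≤ _ := by gcongr
        have h4 : (4 * (r : ℝ)) ^ r * β * 8 ≤ (r : ℝ) ^ (3 * r) * β * (r : ℝ) ^ 42 := by gcongr
        have h5 : (r : ℝ) ^ (3 * r) * β * (r : ℝ) ^ 42 = β * (r : ℝ) ^ (3 * r + 42) := by ring
        linarith
      calc (D : ℝ) ^ r * s ≤ (D : ℝ) ^ r * (c * L) := by gcongr
        _ = (D * β) ^ r * β * L := by rw [← hc]; ring
        _ ≤ (4 * r) ^ r * β * L := by gcongr
        _ ≤ 1 / 8 * L := by gcongr
        _ = L / 8 := by ring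
    have hDexp : (D : ℝ) ≤ Real.exp (L / 2) :=
      (hD1c.trans hcL.le).trans (Real.le_exp_half_self L hL0.le)
    have hreal : (D : ℝ) * 2 ^ (D ^ r * s) * ((D ^ r * s : ℕ) : ℝ) ≤ n := by
      have h3 : ((D ^ r * s : ℕ) : ℝ) ≤ Real.exp (L / 8) := by
        linarith [Real.add_one_le_exp (L / 8)]
      calc _ ≤ Real.exp (L / 2) * Real.exp (L / 8) * Real.exp (L / 8) := by
            gcongr
            exact (h2exp _).trans (Real.exp_le_exp.2 hX)
        _ = Real.exp (L / 2 + L / 8 + L / 8) := by rw [Real.exp_add, Real.exp_add]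
        _ ≤ Real.exp L := Real.exp_le_exp.2 (by linarith)
        _ = n := hnL
    exact_mod_cast hreal
  · intro m hm
    rw [hV] at hm
    rw [Nat.ceil_le]
    set q := √c with hq
    have hq0 : 0 < q := Real.sqrt_pos.2 hc0
    have hqq : q ^ 2 = c := Real.sq_sqrt hc0.le
    have hq1 : 216 * q ≤ 1 := by
      have h1 : (216 * q) ^ 2 ≤ 1 ^ 2 := by
        rw [mul_pow, hqq]
        have h2 : β ^ 3 ≤ β := pow_le_of_le_one hβ.le hβle (by norm_num)
        linarith
      exact le_of_sq_le_sq h1 zero_le_one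
    have hDs : ((D * s : ℕ) : ℝ) ≤ q * L / 2 := by
      push_cast
      -- After squaring, `D c ≤ 4r β^r` is compared with `c = β^(r+1)`; here `2r ≥ r + 2` leaves a
      -- spare factor `β`.
      have h1 : (D : ℝ) * c ≤ q / 2 := by
        have h2 : (D * c * 2) ^ 2 ≤ q ^ 2 := by
          have h3 : D * c ≤ (4 * r) * β ^ r := by
            calc D * c = (D * β) * β ^ r := by rw [← hc]; ring
              _ ≤ _ := by gcongr
          calc (D * c * 2) ^ 2 ≤ ((4 * r) * β ^ r * 2) ^ 2 := by gcongr
            _ = 64 * (r : ℝ) ^ 2 * β ^ (2 * r) := by ring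
            _ ≤ 64 * (r : ℝ) ^ 2 * β ^ (r + 2) := by
                gcongr 64 * (r : ℝ) ^ 2 * ?_
                exact pow_le_pow_of_le_one hβ.le hβle (by omega)
            _ = 64 * (β * (r : ℝ) ^ 2) * c := by rw [← hc]; ring
            _ ≤ 1 * c := by gcongr; linarith
            _ = q ^ 2 := by rw [hqq, one_mul]
        have := le_of_sq_le_sq h2 hq0.le
        linarith
      calc (D : ℝ) * s ≤ D * (c * L) := by gcongr
        _ = (D * c) * L := by ring
        _ ≤ q / 2 * L := by gcongr
        _ = q * L / 2 := by ring
    have hDexp : (D : ℝ) ≤ Real.exp (q * L / 2) := by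
      rw [← hqq] at hD1c hcL
      exact hD1c.trans (Real.inv_sq_le_exp hq0 hq1 hcL.le)
    have hm' : (n : ℝ) ≤ D * 2 ^ (D * s) * m := by exact_mod_cast hm
    -- The pigeonhole loss is at most `n^√c`, which leaves `n^(1-√c)` vertices for the last class.
    have hprod : (D : ℝ) * 2 ^ (D * s) ≤ Real.exp (q * L) := by
      calc _ ≤ Real.exp (q * L / 2) * Real.exp (q * L / 2) := by
            gcongr
            exact (h2exp _).trans (Real.exp_le_exp.2 hDs)
        _ = _ := by rw [← Real.exp_add]; congr 1; ring
    have h1 : Real.exp L ≤ Real.exp (q * L) * m := by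
      rw [hnL]
      exact hm'.trans (by gcongr)
    rw [Real.rpow_def_of_pos hn0, ← hL]
    have h2 : Real.exp L = Real.exp (q * L) * Real.exp (L * (1 - q)) := by
      rw [← Real.exp_add]; congr 1; ring
    rw [h2] at h1
    exact le_of_mul_le_mul_left h1 (Real.exp_pos _)

theorem mainTheorem1 (r n : ℕ) (c ε : ℝ) (hr : 2 ≤ r)
    (hc_pos : 0 < c) (hc : c < 1 / (r : ℝ) ^ (3 * (r + 14) * (r + 1)))
    (hε_pos : 0 < ε) (hε : ε < 1 / (r : ℝ) ^ 24)
    (hn : Real.exp (1 / c) < (n : ℝ))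
    {V : Type*} [Fintype V] (hV : Fintype.card V = n) (G : SimpleGraph V)
    (hG : (1 - 1 / (r : ℝ) - ε) * (n : ℝ) ^ 2 / 2 < (G.edgeSet.ncard : ℝ)) :
    completePartiteGraph (lastClassSizes (r + 1) ⌊c * Real.log n⌋₊ ⌈(n : ℝ) ^ (1 - √c)⌉₊) ⊑ G ∨
      DiffersInFewerThan G (SimpleGraph.turanGraph n r)
        ((ε ^ (1 / 3 : ℝ) + c ^ (1 / (3 * (r : ℝ) + 3))) * (n : ℝ) ^ 2) := by
  have hr2 : (2 : ℝ) ≤ r := by exact_mod_cast hr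
  have hr0 : (0 : ℝ) < r := by linarith
  have hr1 : (1 : ℝ) ≤ r := by linarith
  set e := ε ^ (1 / 3 : ℝ) with he
  set b := c ^ (1 / (3 * (r : ℝ) + 3)) with hb
  have he0 : 0 < e := Real.rpow_pos_of_pos hε_pos _
  have hb0 : 0 < b := Real.rpow_pos_of_pos hc_pos _
  have he3 : e ^ 3 = ε := by
    rw [he, ← Real.rpow_natCast, ← Real.rpow_mul hε_pos.le]
    norm_num
  have hbc : b ^ (3 * (r + 1)) = c := by
    rw [hb, ← Real.rpow_natCast, ← Real.rpow_mul hc_pos.le]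
    have : 1 / (3 * (r : ℝ) + 3) * ((3 * (r + 1) : ℕ) : ℝ) = 1 := by
      push_cast
      field_simp
    rw [this, Real.rpow_one]
  have her : e * (r : ℝ) ^ 8 ≤ 1 := by
    refine (pow_le_one_iff_of_nonneg (by positivity) (by norm_num : (3 : ℕ) ≠ 0)).1 ?_
    rw [mul_pow, he3, ← pow_mul]
    exact ((lt_div_iff₀ (by positivity)).1 hε).le
  have hbr : b * (r : ℝ) ^ (r + 14) ≤ 1 := by
    refine (pow_le_one_iff_of_nonneg (by positivity) (by omega : 3 * (r + 1) ≠ 0)).1 ?_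
    rw [mul_pow, hbc, ← pow_mul, show (r + 14) * (3 * (r + 1)) = 3 * (r + 14) * (r + 1) by ring]
    exact ((lt_div_iff₀ (by positivity)).1 hc).le
  -- The threshold `β = b³` satisfies `β^(r+1) = c`, as the embedding requires.
  rcases le_or_gt (b ^ 3 * (n : ℝ) ^ (r + 1)) ((G.cliqueTuples Finset.univ (r + 1)).card : ℝ)
    with hK | hK
  · left
    refine completePartiteGraph_isContained_of_many_cliques hV hr (β := b ^ 3) (by positivity) ?_
      (by rw [← pow_mul]; exact hbc) hn hK
    calc b ^ 3 * (r : ℝ) ^ (3 * r + 42) = (b * (r : ℝ) ^ (r + 14)) ^ 3 := by ring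
      _ ≤ 1 := pow_le_one₀ (by positivity) hbr
  · right
    obtain ⟨p, rfl⟩ : ∃ p, r = p + 2 := ⟨r - 2, by omega⟩
    refine SimpleGraph.differsInFewerThan_turanGraph_of_few_cliques hV hb0 he0 hbr her
      (σ := (e + b) / ((p + 2 : ℕ) : ℝ) ^ 3) (by field_simp) ?_ ?_ hK
    · have hb1 : b ≤ 1 := by
        refine le_trans (le_mul_of_one_le_right hb0.le ?_) hbr
        exact one_le_pow₀ hr1
      have hn1 : 1 / c ≤ n := by linarith [Real.add_one_le_exp (1 / c)]
      have h1 : 1 ≤ c * n := by rwa [div_le_iff₀' hc_pos] at hn1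
      have h2 : c ≤ b ^ 2 := by
        rw [← hbc]; exact pow_le_pow_of_le_one hb0.le hb1 (by omega)
      -- This yields `r ≤ σn`; it holds because `n > 1/c` and `c ≤ b²`.
      have h3 : ((p + 2 : ℕ) : ℝ) ^ 4 ≤ b * n := by
        have h4 : b * ((p + 2 : ℕ) : ℝ) ^ 4 ≤ b * (b * n) := by
          calc b * ((p + 2 : ℕ) : ℝ) ^ 4 ≤ b * ((p + 2 : ℕ) : ℝ) ^ (p + 2 + 14) := by
                gcongr
                omega
            _ ≤ 1 := hbr
            _ ≤ c * n := h1
            _ ≤ b ^ 2 * n := by gcongr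
            _ = b * (b * n) := by ring
        exact le_of_mul_le_mul_left h4 hb0
      rw [div_mul_eq_mul_div, le_div_iff₀ (by positivity), ← pow_succ']
      have h5 : 0 ≤ e * n := by positivity
      norm_num at h3 ⊢
      linarith
    · have h1 : (G.adjPairs.card : ℝ) = 2 * G.edgeSet.ncard := by exact_mod_cast G.card_adjPairs
      rw [he3, h1]
      linarith
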